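/- Let $K$ be a field of characteristic $0$, let $\mathrm{GW}(K)$ be its Grothendieck–Witt ring (the Grothendieck group of the monoid, under direct sum, of isomorphism classes of finite-dimensional $K$-vector spaces with a nondegenerate symmetric bilinear form, with multiplication induced by the tensor product). For $a\in K^\times$ let $\langle a\rangle$ be the class of $K$ with the form $(x,y)\mapsto axy$, and let $\mathbb H=\langle 1\rangle+\langle -1\rangle$. For an integer $w\ge 1$ put $m(w)=\frac{w-1}{2}\,\mathbb H+\langle w\rangle$ if $w$ is odd and $m(w)=\frac w2\,\mathbb H$ if $w$ is even. A *floor diagram of degree $d$* is a loopless multigraph $\mathcal D$ (possibly disconnected) on the vertex set $\{1,\dots,d\}$, with edges oriented towards the larger vertex and weighted by positive integers, such that at every vertex the divergence (total weight of incoming edges minus total weight of outgoing edges) is at most $1$; diagrams that differ only by renaming edges are identified. Its genus is $g(\mathcal D)=\#\text{edges}-d+1$ and its cogenus is $\delta(\mathcal D)=\frac{(d-1)(d-2)}2-g(\mathcal D)$. A *marking* of $\mathcal D$ is obtained as follows: call the vertices of $\mathcal D$ white; insert a black vertex in the middle of each edge, the two new edges inheriting weight and orientation; add $d$ further black vertices,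 each with one outgoing edge of weight $1$ ending in a white vertex, so that every white vertex has divergence exactly $1$; and extend the order of the white vertices to a total order on all vertices that is compatible with the orientation of all edges. Two markings are equivalent if there is an order-preserving isomorphism of weighted graphs between them that fixes the white vertices; $\nu(\mathcal D)$ denotes the number of markings up to equivalence. The arithmetic multiplicity of $\mathcal D$ is the product of $m(w(e))$ over all edges $e$ of a marking of $\mathcal D$, so that every edge of weight $w$ of $\mathcal D$ contributes $m(w)^2$ and every added edge contributes $m(1)=\langle 1\rangle$. Set $$N^{\delta}_{\mathbb A^1}(d)=\sum_{\mathcal D}\nu(\mathcal D)\,\mathrm{mult}_{\mathbb A^1}(\mathcal D)\in\mathrm{GW}(K),$$ the sum running over all floor diagrams of degree $d$ and cogenus $\delta$. **Theorem.** Let $K$ be a field of characteristic $0$. For every integer $\delta\ge 0$ there are polynomials $P,Q\in\mathbb Q[d]$ of degree $2\delta$ (where, for $P$ in the case $\delta=0$, the zero polynomial is allowed and counts as having degree $0$) such that for all sufficiently large integers $d$ the values $P(d)$ and $Q(d)$ are integers and $$N^{\delta}_{\mathbb A^1}(d)=P(d)\,\mathbb H+Q(d)\,\langle 1\rangle .$$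 -/

import Mathlib

open scoped TensorProduct

universe u

/-! ### The Grothendieck–Witt ring of a field -/

/-- A quadratic space over `K`: a finite-dimensional vector space with a nondegenerate symmetric
bilinear form. -/
structure QuadSpace (K : Type u) [Field K] where
  V : Type u
  [addCommGroup : AddCommGroup V]
  [module : Module K V]
  [finite : FiniteDimensional K V]
  form : LinearMap.BilinForm K V
  symm : ∀ x y, form x y = form y x
  nondeg : form.Nondegenerate

attribute [instance] QuadSpace.addCommGroup QuadSpace.module QuadSpace.finite

namespace QuadSpace

variable {K : Type u} [Field K]

theorem nondeg_of_symm {V : Type u} [AddCommGroup V] [Module K V] (B : LinearMap.BilinForm K V)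
    (hs : ∀ x y, B x y = B y x) (h : ∀ x, (∀ y, B x y = 0) → x = 0) : B.Nondegenerate :=
  ⟨fun x hx => h x hx, fun y hy => h y fun x => by rw [hs]; exact hy x⟩

/-- Two quadratic spaces are isomorphic if there is a linear isomorphism preserving the forms. -/
def Iso (A B : QuadSpace K) : Prop :=
  ∃ e : A.V ≃ₗ[K] B.V, ∀ x y, B.form (e x) (e y) = A.form x y

instance isoSetoid (K : Type u) [Field K] : Setoid (QuadSpace K) where
  r := Iso
  iseqv :=
    { refl := fun A => ⟨LinearEquiv.refl K A.V, fun _ _ => rfl⟩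
      symm := fun {A B} ⟨e, he⟩ => ⟨e.symm, fun x y => by
        rw [← he, e.apply_symm_apply, e.apply_symm_apply]⟩
      trans := fun {A B C} ⟨e, he⟩ ⟨f, hf⟩ => ⟨e.trans f, fun x y => by
        rw [LinearEquiv.trans_apply, LinearEquiv.trans_apply, hf, he]⟩ }

/-- The zero space. -/
@[reducible]
def zero (K : Type u) [Field K] : QuadSpace K where
  V := PUnit.{u+1}
  form := 0
  symm := fun _ _ => rfl
  nondeg := nondeg_of_symm _ (fun _ _ => rfl) fun _ _ => rfl

/-- The one-dimensional space `⟨a⟩`, that is, `K` with the form `(x, y) ↦ a * x * y`. -/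
@[reducible]
def diag (a : Kˣ) : QuadSpace K where
  V := K
  form := (a : K) • LinearMap.mul K K
  symm := fun x y => by simp [mul_comm]
  nondeg := nondeg_of_symm _ (fun x y => by simp [mul_comm]) fun x hx => by
    simpa using hx 1

/-- Orthogonal direct sum. -/
@[reducible]
def sum (A B : QuadSpace K) : QuadSpace K where
  V := A.V × B.V
  form := A.form.compl₁₂ (LinearMap.fst K A.V B.V) (LinearMap.fst K A.V B.V) +
    B.form.compl₁₂ (LinearMap.snd K A.V B.V) (LinearMap.snd K A.V B.V)
  symm := fun x y => by simp [A.symm x.1, B.symm x.2]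
  nondeg := nondeg_of_symm _ (fun x y => by simp [A.symm x.1, B.symm x.2]) fun x hx => by
    refine Prod.ext (A.nondeg.1 x.1 fun y => ?_) (B.nondeg.1 x.2 fun y => ?_)
    · simpa using hx (y, 0)
    · simpa using hx (0, y)

theorem sum_form (A B : QuadSpace K) (x y : A.V × B.V) :
    (A.sum B).form x y = A.form x.1 y.1 + B.form x.2 y.2 := rfl

theorem tmul_symm (A B : QuadSpace K) (x y : A.V ⊗[K] B.V) :
    LinearMap.BilinForm.tmul A.form B.form x y = LinearMap.BilinForm.tmul A.form B.form y x :=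
  (LinearMap.IsSymm.tmul ⟨A.symm⟩ ⟨B.symm⟩).eq x y

theorem tmul_inj (A B : QuadSpace K) (x : A.V ⊗[K] B.V)
    (hx : ∀ y, LinearMap.BilinForm.tmul A.form B.form x y = 0) : x = 0 := by
  have key : (LinearMap.BilinForm.tmul A.form B.form : A.V ⊗[K] B.V →ₗ[K] _) =
      (TensorProduct.dualDistribEquiv K A.V B.V).toLinearMap ∘ₗ
        (TensorProduct.congr (A.form.toDual A.nondeg) (B.form.toDual B.nondeg)).toLinearMap := by
    apply TensorProduct.ext'
    intro a b
    apply TensorProduct.ext'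
    intro c d
    simp [TensorProduct.dualDistribEquiv, TensorProduct.dualDistribEquivOfBasis,
      LinearMap.BilinForm.toDual_def, mul_comm]
  have h0 : LinearMap.BilinForm.tmul A.form B.form x = 0 := LinearMap.ext hx
  rw [key, LinearMap.comp_apply, LinearEquiv.coe_coe, LinearEquiv.coe_coe,
    LinearEquiv.map_eq_zero_iff, LinearEquiv.map_eq_zero_iff] at h0
  exact h0

/-- Tensor product; the form is determined by
`(a ⊗ b, a' ⊗ b') ↦ A.form a a' * B.form b b'`. -/
@[reducible]
noncomputable def tensor (A B : QuadSpace K) : QuadSpace K where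
  V := A.V ⊗[K] B.V
  form := LinearMap.BilinForm.tmul A.form B.form
  symm := tmul_symm A B
  nondeg := nondeg_of_symm _ (tmul_symm A B) (tmul_inj A B)

theorem tensor_form (A B : QuadSpace K) (a a' : A.V) (b b' : B.V) :
    (A.tensor B).form (a ⊗ₜ[K] b) (a' ⊗ₜ[K] b') = A.form a a' * B.form b b' := by
  simp [mul_comm]

/-- To compare two forms it suffices to compare them on pure tensors. -/
theorem form_ext_tensor {A B C : QuadSpace K} (e : A.V ⊗[K] B.V →ₗ[K] C.V)
    (h : ∀ a b a' b', C.form (e (a ⊗ₜ[K] b)) (e (a' ⊗ₜ[K] b')) = A.form a a' * B.form b b')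
    (x y : A.V ⊗[K] B.V) : C.form (e x) (e y) = (A.tensor B).form x y := by
  have : C.form.compl₁₂ e e = (A.tensor B).form := by
    apply TensorProduct.ext'
    intro a b
    apply TensorProduct.ext'
    intro a' b'
    rw [tensor_form]
    exact h a b a' b'
  exact LinearMap.congr_fun (LinearMap.congr_fun this x) y

theorem sum_congr {A A' B B' : QuadSpace K} (hA : Iso A A') (hB : Iso B B') :
    Iso (A.sum B) (A'.sum B') := by
  obtain ⟨e, he⟩ := hA
  obtain ⟨f, hf⟩ := hB
  refine ⟨LinearEquiv.prodCongr e f, fun x y => ?_⟩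
  rw [sum_form, sum_form, ← he, ← hf]; rfl

theorem tensor_congr {A A' B B' : QuadSpace K} (hA : Iso A A') (hB : Iso B B') :
    Iso (A.tensor B) (A'.tensor B') := by
  obtain ⟨e, he⟩ := hA
  obtain ⟨f, hf⟩ := hB
  refine ⟨TensorProduct.congr e f, fun x y => ?_⟩
  refine form_ext_tensor (C := A'.tensor B') (TensorProduct.congr e f).toLinearMap ?_ x y
  intro a b a' b'
  rw [← he, ← hf]
  exact tensor_form _ _ _ _ _ _

theorem sum_comm (A B : QuadSpace K) : Iso (A.sum B) (B.sum A) :=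
  ⟨LinearEquiv.prodComm K A.V B.V, fun x y => by
    rw [sum_form, sum_form]; exact add_comm _ _⟩

theorem sum_assoc (A B C : QuadSpace K) : Iso ((A.sum B).sum C) (A.sum (B.sum C)) :=
  ⟨LinearEquiv.prodAssoc K A.V B.V C.V, fun x y => by
    exact (add_assoc _ _ _).symm⟩

theorem zero_sum (A : QuadSpace K) : Iso ((zero K).sum A) A :=
  ⟨LinearEquiv.uniqueProd (R := K) (M := A.V) (M₂ := PUnit.{u+1}), fun x y => by
    rw [sum_form]; exact (zero_add _).symm⟩

theorem tensor_comm (A B : QuadSpace K) : Iso (A.tensor B) (B.tensor A) := by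
  refine ⟨TensorProduct.comm K A.V B.V, fun x y => ?_⟩
  refine form_ext_tensor (C := B.tensor A) (TensorProduct.comm K A.V B.V).toLinearMap ?_ x y
  intro a b a' b'
  exact (tensor_form _ _ _ _ _ _).trans (mul_comm _ _)

theorem tensor_assoc (A B C : QuadSpace K) :
    Iso ((A.tensor B).tensor C) (A.tensor (B.tensor C)) := by
  let e := TensorProduct.assoc K A.V B.V C.V
  refine ⟨e, fun x y => ?_⟩
  have : ((A.tensor (B.tensor C)).form.compl₁₂ e.toLinearMap e.toLinearMap :
      LinearMap.BilinForm K ((A.V ⊗[K] B.V) ⊗[K] C.V)) = ((A.tensor B).tensor C).form := by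
    apply TensorProduct.ext_threefold
    intro a b c
    apply TensorProduct.ext_threefold
    intro a' b' c'
    refine (tensor_form A (B.tensor C) a a' (b ⊗ₜ c) (b' ⊗ₜ c')).trans ?_
    refine Eq.trans ?_ (tensor_form (A.tensor B) C (a ⊗ₜ b) (a' ⊗ₜ b') c c').symm
    rw [tensor_form, tensor_form, mul_assoc]
  exact LinearMap.congr_fun (LinearMap.congr_fun this x) y

theorem one_tensor (A : QuadSpace K) : Iso ((diag 1).tensor A) A := by
  refine ⟨TensorProduct.lid K A.V, fun x y => ?_⟩
  refine form_ext_tensor (A := diag 1) (C := A) (TensorProduct.lid K A.V).toLinearMap ?_ x y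
  intro a b a' b'
  simp [mul_assoc, mul_left_comm]

theorem zero_tensor (A : QuadSpace K) : Iso ((zero K).tensor A) (zero K) := by
  have h : ∀ x : PUnit.{u+1} ⊗[K] A.V, x = 0 := fun x => by
    induction x using TensorProduct.induction_on with
    | zero => rfl
    | tmul a b => rw [Subsingleton.elim a 0, TensorProduct.zero_tmul]
    | add x y hx hy => rw [hx, hy, add_zero]
  have : Subsingleton (((zero K).tensor A).V) := ⟨fun x y => (h x).trans (h y).symm⟩
  have : Subsingleton ((zero K).V) := inferInstanceAs (Subsingleton PUnit.{u+1})
  refine ⟨0, fun x y => ?_⟩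
  rw [Subsingleton.elim x 0]; simp

theorem sum_tensor (A B C : QuadSpace K) :
    Iso ((A.sum B).tensor C) ((A.tensor C).sum (B.tensor C)) := by
  let e : (A.V × B.V) ⊗[K] C.V ≃ₗ[K] (A.V ⊗[K] C.V) × (B.V ⊗[K] C.V) :=
    TensorProduct.prodLeft K K A.V B.V C.V
  refine ⟨e, fun x y => ?_⟩
  refine form_ext_tensor (A := A.sum B) (C := (A.tensor C).sum (B.tensor C)) e.toLinearMap ?_ x y
  rintro ⟨a, b⟩ c ⟨a', b'⟩ c'
  refine (sum_form (A.tensor C) (B.tensor C) (a ⊗ₜ c, b ⊗ₜ c) (a' ⊗ₜ c', b' ⊗ₜ c')).trans ?_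
  rw [tensor_form, tensor_form, sum_form, add_mul]

end QuadSpace

/-- Isomorphism classes of quadratic spaces over `K`. -/
def QuadClass (K : Type u) [Field K] : Type (u + 1) := Quotient (QuadSpace.isoSetoid K)

noncomputable instance QuadClass.instAdd (K : Type u) [Field K] : Add (QuadClass K) :=
  ⟨Quotient.map₂ QuadSpace.sum fun _ _ h _ _ h' => QuadSpace.sum_congr h h'⟩

noncomputable instance QuadClass.instZero (K : Type u) [Field K] : Zero (QuadClass K) :=
  ⟨Quotient.mk _ (QuadSpace.zero K)⟩

noncomputable instance QuadClass.instMul (K : Type u) [Field K] : Mul (QuadClass K) :=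
  ⟨Quotient.map₂ QuadSpace.tensor fun _ _ h _ _ h' => QuadSpace.tensor_congr h h'⟩

noncomputable instance QuadClass.instOne (K : Type u) [Field K] : One (QuadClass K) :=
  ⟨Quotient.mk _ (QuadSpace.diag 1)⟩

/-- Isomorphism classes form a commutative semiring under direct sum and tensor product. -/
noncomputable instance QuadClass.instCommSemiring (K : Type u) [Field K] :
    CommSemiring (QuadClass K) where
  nsmul := nsmulRec
  npow := npowRec
  add_comm := by rintro ⟨a⟩ ⟨b⟩; exact Quotient.sound (QuadSpace.sum_comm a b)
  add_assoc := by rintro ⟨a⟩ ⟨b⟩ ⟨c⟩; exact Quotient.sound (QuadSpace.sum_assoc a b c)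
  zero_add := by rintro ⟨a⟩; exact Quotient.sound (QuadSpace.zero_sum a)
  add_zero := by
    rintro ⟨a⟩
    exact Quotient.sound (Setoid.trans (QuadSpace.sum_comm a _) (QuadSpace.zero_sum a))
  mul_comm := by rintro ⟨a⟩ ⟨b⟩; exact Quotient.sound (QuadSpace.tensor_comm a b)
  mul_assoc := by rintro ⟨a⟩ ⟨b⟩ ⟨c⟩; exact Quotient.sound (QuadSpace.tensor_assoc a b c)
  one_mul := by rintro ⟨a⟩; exact Quotient.sound (QuadSpace.one_tensor a)
  mul_one := by
    rintro ⟨a⟩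
    exact Quotient.sound (Setoid.trans (QuadSpace.tensor_comm a _) (QuadSpace.one_tensor a))
  zero_mul := by rintro ⟨a⟩; exact Quotient.sound (QuadSpace.zero_tensor a)
  mul_zero := by
    rintro ⟨a⟩
    exact Quotient.sound (Setoid.trans (QuadSpace.tensor_comm a _) (QuadSpace.zero_tensor a))
  right_distrib := by
    rintro ⟨a⟩ ⟨b⟩ ⟨c⟩; exact Quotient.sound (QuadSpace.sum_tensor a b c)
  left_distrib := by
    rintro ⟨a⟩ ⟨b⟩ ⟨c⟩
    exact Quotient.sound (Setoid.trans (QuadSpace.tensor_comm a _)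
      (Setoid.trans (QuadSpace.sum_tensor b c a)
        (QuadSpace.sum_congr (QuadSpace.tensor_comm b a) (QuadSpace.tensor_comm c a))))

/-- The Grothendieck–Witt ring: the Grothendieck group of the additive monoid of isomorphism
classes of quadratic spaces. -/
def GW (K : Type u) [Field K] : Type (u + 1) := Algebra.GrothendieckAddGroup (QuadClass K)

namespace GW

variable {K : Type u} [Field K]

noncomputable instance instAddCommGroup : AddCommGroup (GW K) :=
  inferInstanceAs (AddCommGroup (Algebra.GrothendieckAddGroup (QuadClass K)))

/-- The canonical additive map from isomorphism classes to the Grothendieck group. -/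
noncomputable def of : QuadClass K →+ GW K :=
  (Algebra.GrothendieckAddGroup.of : QuadClass K →+ Algebra.GrothendieckAddGroup (QuadClass K))

/-- Additive maps to a group extend uniquely to the Grothendieck group. -/
noncomputable def lift {G : Type*} [AddCommGroup G] (f : QuadClass K →+ G) : GW K →+ G :=
  (Algebra.GrothendieckAddGroup.lift f : Algebra.GrothendieckAddGroup (QuadClass K) →+ G)

theorem lift_of {G : Type*} [AddCommGroup G] (f : QuadClass K →+ G) (s : QuadClass K) :
    lift f (of s) = f s :=
  DFunLike.congr_fun (Algebra.GrothendieckAddGroup.lift.symm_apply_apply f) s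

theorem hom_ext {G : Type*} [AddCommGroup G] {f g : GW K →+ G}
    (h : ∀ s, f (of s) = g (of s)) : f = g :=
  Algebra.GrothendieckAddGroup.lift.symm.injective (AddMonoidHom.ext h)

/-- The biadditive multiplication on the Grothendieck group that extends the tensor product. -/
noncomputable def mulHom (K : Type u) [Field K] : GW K →+ GW K →+ GW K :=
  lift
    { toFun := fun s => lift (of.comp (AddMonoidHom.mulLeft s))
      map_zero' := hom_ext fun t => by simp [lift_of]
      map_add' := fun a b => hom_ext fun t => by simp [lift_of, add_mul] }

theorem mulHom_of (s t : QuadClass K) : mulHom K (of s) (of t) = of (s * t) := by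
  simp [mulHom, lift_of]

theorem mulHom_comm : (mulHom K).flip = mulHom K :=
  hom_ext fun s => hom_ext fun t => by
    rw [AddMonoidHom.flip_apply, mulHom_of, mulHom_of, mul_comm]

theorem mulHom_assoc (x y z : GW K) :
    mulHom K (mulHom K x y) z = mulHom K x (mulHom K y z) := by
  have h : (AddMonoidHom.compHom (mulHom K)).comp (mulHom K) =
      (AddMonoidHom.compHom.flip (mulHom K)).comp
        (AddMonoidHom.compHom.comp (mulHom K)) := by
    refine hom_ext fun s => hom_ext fun t => hom_ext fun r => ?_
    simp [mulHom_of, mul_assoc]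
  exact DFunLike.congr_fun (DFunLike.congr_fun (DFunLike.congr_fun h x) y) z

theorem one_mulHom : mulHom K (of 1) = AddMonoidHom.id (GW K) :=
  hom_ext fun s => by rw [mulHom_of, one_mul]; rfl

noncomputable instance instMul : Mul (GW K) := ⟨fun x y => mulHom K x y⟩

noncomputable instance instOne : One (GW K) := ⟨of 1⟩

/-- The ring structure on the Grothendieck–Witt group induced by the tensor product. -/
noncomputable instance instCommRing : CommRing (GW K) where
  __ := instAddCommGroup
  npow := npowRec
  mul_comm := fun x y => (DFunLike.congr_fun (DFunLike.congr_fun mulHom_comm x) y).symm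
  mul_assoc := mulHom_assoc
  one_mul := fun x => DFunLike.congr_fun one_mulHom x
  mul_one := fun x => (DFunLike.congr_fun (DFunLike.congr_fun mulHom_comm (of 1)) x).trans
    (DFunLike.congr_fun one_mulHom x)
  zero_mul := fun x => by
    change mulHom K 0 x = 0
    simp
  mul_zero := fun x => by
    change mulHom K x 0 = 0
    simp
  left_distrib := fun x y z => map_add (mulHom K x) y z
  right_distrib := fun x y z => by
    change mulHom K (x + y) z = mulHom K x z + mulHom K y z
    simp

/-- The class `⟨a⟩`. -/
noncomputable def diag (a : Kˣ) : GW K := of (Quotient.mk _ (QuadSpace.diag a))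

/-- The hyperbolic plane `⟨1⟩ + ⟨-1⟩`. -/
noncomputable def hyp (K : Type u) [Field K] : GW K := diag 1 + diag (-1)

end GW

/-! ### Floor diagrams of plane curves of degree `d` -/

/-- A weighted oriented edge `src → tgt` between elements of the vertex set `{1, …, d}`, which is
modelled by `Fin d`. -/
@[ext]
structure WEdge (d : ℕ) where
  src : Fin d
  tgt : Fin d
  wt : ℕ

noncomputable instance WEdge.instDecidableEq (d : ℕ) : DecidableEq (WEdge d) :=
  Classical.decEq _

/-- The divergence at `v`: total incoming weight minus total outgoing weight. -/
noncomputable def edgeDiv {d : ℕ} (E : Multiset (WEdge d)) (v : Fin d) : ℤ :=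
  (E.map fun e => if e.tgt = v then (e.wt : ℤ) else 0).sum -
    (E.map fun e => if e.src = v then (e.wt : ℤ) else 0).sum

/-- A floor diagram of degree `d` (for the triangle with vertices `(0,0)`, `(0,d)`, `(d,0)`): a
loopless multigraph on `d` ordered vertices, with positive integer edge weights and with edges
oriented towards the larger vertex, such that every vertex has divergence at most `1`. A multigraph
with a fixed vertex set is, up to renaming the edges, the multiset of its weighted edges. -/
@[ext]
structure FloorDiagram (d : ℕ) where
  edges : Multiset (WEdge d)
  src_lt_tgt : ∀ e ∈ edges, e.src < e.tgt
  wt_pos : ∀ e ∈ edges, 1 ≤ e.wt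
  div_le : ∀ v, edgeDiv edges v ≤ 1

namespace FloorDiagram

variable {d : ℕ}

/-- The genus `1 - χ` of the underlying graph, that is, `#edges - #vertices + 1`. For a connected
graph it is the first Betti number; diagrams that are not connected are allowed, as the curves that
they count may be reducible. -/
def genus (D : FloorDiagram d) : ℤ := (D.edges.card : ℤ) - d + 1

/-- The cogenus (number of nodes) `(d - 1)(d - 2)/2 - g`. -/
def cogenus (D : FloorDiagram d) : ℤ := ((d : ℤ) - 1) * ((d : ℤ) - 2) / 2 - D.genus

/-- There are only finitely many floor diagrams of given degree. -/
instance instFinite (d : ℕ) : Finite (FloorDiagram d) := by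
  classical
  -- the sum of all weights is at most `∑ v, v`
  have hsum : ∀ E : Multiset (WEdge d), (∑ v : Fin d, (v : ℤ) * edgeDiv E v) =
      (E.map fun e => (e.wt : ℤ) * ((e.tgt : ℤ) - (e.src : ℤ))).sum := by
    intro E
    induction E using Multiset.induction_on with
    | empty => simp [edgeDiv]
    | cons a s ih =>
      have h1 : ∀ v : Fin d, edgeDiv (a ::ₘ s) v = edgeDiv s v +
          ((if a.tgt = v then (a.wt : ℤ) else 0) - (if a.src = v then (a.wt : ℤ) else 0)) := by
        intro v; simp only [edgeDiv, Multiset.map_cons, Multiset.sum_cons]; ring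
      simp only [h1, mul_add, Finset.sum_add_distrib, ih, Multiset.map_cons, Multiset.sum_cons,
        mul_sub, Finset.sum_sub_distrib, mul_ite, mul_zero, Finset.sum_ite_eq, Finset.mem_univ,
        if_true]
      ring
  have hle : ∀ D : FloorDiagram d, (D.edges.map fun e => e.wt).sum ≤ ∑ v : Fin d, (v : ℕ) := by
    intro D
    have h1 : (D.edges.map fun e => (e.wt : ℤ)).sum ≤
        (D.edges.map fun e => (e.wt : ℤ) * ((e.tgt : ℤ) - (e.src : ℤ))).sum := by
      apply Multiset.sum_map_le_sum_map
      intro e he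
      have := D.src_lt_tgt e he
      have h2 : (1 : ℤ) ≤ (e.tgt : ℤ) - (e.src : ℤ) := by
        have : (e.src : ℕ) < (e.tgt : ℕ) := this
        omega
      nlinarith [Int.natCast_nonneg e.wt]
    have h2 : (∑ v : Fin d, (v : ℤ) * edgeDiv D.edges v) ≤ ∑ v : Fin d, (v : ℤ) := by
      apply Finset.sum_le_sum
      intro v _
      have := D.div_le v
      have h0 : (0 : ℤ) ≤ (v : ℤ) := Int.natCast_nonneg _
      nlinarith
    rw [← hsum] at h1
    have h3 := h1.trans h2
    have h4 : (((D.edges.map fun e => e.wt).sum : ℕ) : ℤ) = (D.edges.map fun e => (e.wt : ℤ)).sum := by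
      exact (map_multiset_sum (Nat.castRingHom ℤ) _).trans (by rw [Multiset.map_map]; rfl)
    rw [← h4] at h3
    exact_mod_cast h3
  set N := ∑ v : Fin d, (v : ℕ) with hN
  have hwt : ∀ D : FloorDiagram d, ∀ e ∈ D.edges, e.wt ≤ N := fun D e he =>
    (Multiset.single_le_sum (fun _ _ => Nat.zero_le _) _
      (Multiset.mem_map_of_mem (fun e : WEdge d => e.wt) he)).trans (hle D)
  have hcard : ∀ D : FloorDiagram d, ∀ e, D.edges.count e ≤ N := by
    intro D e
    refine (Multiset.count_le_card _ _).trans (le_trans ?_ (hle D))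
    have := Multiset.card_nsmul_le_sum (s := D.edges.map fun e => e.wt) (a := 1)
      (fun x hx => by
        obtain ⟨e, he, rfl⟩ := Multiset.mem_map.1 hx
        exact D.wt_pos e he)
    simpa using this
  let F : FloorDiagram d → (Fin d × Fin d × Fin (N + 1) → Fin (N + 1)) := fun D p =>
    ⟨D.edges.count ⟨p.1, p.2.1, p.2.2⟩, Nat.lt_succ_of_le (hcard D _)⟩
  refine Finite.of_injective F fun D D' h => ?_
  apply FloorDiagram.ext
  apply Multiset.ext.2
  intro e
  by_cases hw : e.wt ≤ N
  · have := congrArg Fin.val (congrFun h (e.src, e.tgt, ⟨e.wt, Nat.lt_succ_of_le hw⟩))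
    exact this
  · rw [Multiset.count_eq_zero_of_notMem (fun he => hw (hwt D e he)),
      Multiset.count_eq_zero_of_notMem (fun he => hw (hwt D' e he))]

noncomputable instance instFintype (d : ℕ) : Fintype (FloorDiagram d) := Fintype.ofFinite _

/-- The vertices of a marked floor diagram: the `d` white vertices (first summand), one black vertex
in the middle of every edge (second summand), and one black vertex for each of the `d` left ends of
weight `1` (third summand). -/
abbrev MVertex (D : FloorDiagram d) : Type := Fin d ⊕ (D.edges ⊕ Fin d)

/-- A marking of a floor diagram, of the degree `d` in which all `d` left ends have weight `1` and
there are no right ends. -/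
structure Marking (D : FloorDiagram d) where
  /-- The white vertex at which the edge starting at the `i`-th left black vertex ends. -/
  target : Fin d → Fin d
  /-- After adding the left ends, every white vertex has divergence `1`. -/
  div_eq : ∀ v, edgeDiv D.edges v + (Finset.univ.filter fun i => target i = v).card = 1
  /-- A total order on all vertices, given as the increasing enumeration of the vertices. -/
  pos : D.MVertex ≃ Fin (Fintype.card D.MVertex)
  /-- The order extends the order of the white vertices. -/
  white_lt : ∀ v w : Fin d, v < w → pos (Sum.inl v) < pos (Sum.inl w)
  /-- The order is compatible with the orientation of all edges. -/
  src_lt : ∀ e : D.edges, pos (Sum.inl e.1.src) < pos (Sum.inr (Sum.inl e))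
  lt_tgt : ∀ e : D.edges, pos (Sum.inr (Sum.inl e)) < pos (Sum.inl e.1.tgt)
  end_lt : ∀ i : Fin d, pos (Sum.inr (Sum.inr i)) < pos (Sum.inl (target i))

/-- The graph underlying a marking: the weight of the edge from one vertex to another, or `0` if
there is no such edge. (The graph has no multiple edges.) -/
noncomputable def Marking.adj {D : FloorDiagram d} (M : D.Marking) : D.MVertex → D.MVertex → ℕ
  | Sum.inl v, Sum.inr (Sum.inl e) => if e.1.src = v then e.1.wt else 0
  | Sum.inr (Sum.inl e), Sum.inl v => if e.1.tgt = v then e.1.wt else 0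
  | Sum.inr (Sum.inr i), Sum.inl v => if M.target i = v then 1 else 0
  | _, _ => 0

/-- Two markings are equivalent if there is an isomorphism of weighted graphs between them that
fixes the white vertices (and respects the total orders, which are part of the markings). -/
instance markingSetoid (D : FloorDiagram d) : Setoid D.Marking where
  r M M' := ∃ σ : D.MVertex ≃ D.MVertex, (∀ v : Fin d, σ (Sum.inl v) = Sum.inl v) ∧
    (∀ x y, M'.adj (σ x) (σ y) = M.adj x y) ∧
    (∀ x y, M'.pos (σ x) < M'.pos (σ y) ↔ M.pos x < M.pos y)
  iseqv :=
    { refl := fun M => ⟨Equiv.refl _, fun _ => rfl, fun _ _ => rfl, fun _ _ => Iff.rfl⟩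
      symm := fun {M M'} ⟨σ, h1, h2, h3⟩ => ⟨σ.symm, fun v => by
          rw [Equiv.symm_apply_eq, h1], fun x y => by
          rw [← h2, σ.apply_symm_apply, σ.apply_symm_apply], fun x y => by
          rw [← h3, σ.apply_symm_apply, σ.apply_symm_apply]⟩
      trans := fun {M M' M''} ⟨σ, h1, h2, h3⟩ ⟨τ, k1, k2, k3⟩ => ⟨σ.trans τ, fun v => by
          rw [Equiv.trans_apply, h1, k1], fun x y => by
          rw [Equiv.trans_apply, Equiv.trans_apply, k2, h2], fun x y => by
          rw [Equiv.trans_apply, Equiv.trans_apply, k3, h3]⟩ }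

/-- The number `ν(D)` of markings up to equivalence. -/
noncomputable def nu (D : FloorDiagram d) : ℕ := Nat.card (Quotient D.markingSetoid)

end FloorDiagram

/-! ### Arithmetic multiplicities and the arithmetic count -/

/-- The arithmetic multiplicity of an edge of weight `w` (over a field of characteristic zero). -/
noncomputable def edgeMult (K : Type u) [Field K] [CharZero K] (w : ℕ) : GW K :=
  if h : Odd w then
    ((w - 1) / 2) • GW.hyp K + GW.diag (Units.mk0 (w : K) (Nat.cast_ne_zero.2 h.pos.ne'))
  else (w / 2) • GW.hyp K

/-- The arithmetic multiplicity of a floor diagram: the product of the multiplicities of all edges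
of the diagram after marking, where every edge of `D` is cut by a black vertex into two edges of the
same weight, and there are `d` further edges of weight `1` coming from the left ends. -/
noncomputable def FloorDiagram.mult (K : Type u) [Field K] [CharZero K] {d : ℕ}
    (D : FloorDiagram d) : GW K :=
  (D.edges.map fun e => edgeMult K e.wt * edgeMult K e.wt).prod * ∏ _i : Fin d, edgeMult K 1

open Classical in
/-- The arithmetic count of floor diagrams of degree `d` and cogenus `δ`. -/
noncomputable def arithmeticCount (K : Type u) [Field K] [CharZero K] (δ d : ℕ) : GW K :=
  ∑ D : FloorDiagram d with D.cogenus = (δ : ℤ), D.nu • D.mult K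

/-! ### Arithmetic multiplicities in the subring generated by the hyperbolic plane -/

namespace GW

variable {K : Type u} [Field K]

theorem of_mul_of (s t : QuadClass K) : of s * of t = of (s * t) := mulHom_of s t

theorem diag_one : diag (1 : Kˣ) = 1 := rfl

theorem diag_mul_diag (a b : Kˣ) : diag a * diag b = diag (a * b) := by
  refine (of_mul_of _ _).trans (congrArg of (Quotient.sound ?_))
  refine ⟨TensorProduct.lid K K, fun x y => ?_⟩
  refine QuadSpace.form_ext_tensor (A := QuadSpace.diag a) (B := QuadSpace.diag b)
    (C := QuadSpace.diag (a * b)) (TensorProduct.lid K K).toLinearMap ?_ x y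
  intro c d c' d'
  simp
  ring

theorem diag_mul_self (a : Kˣ) : diag (a * a) = 1 := by
  refine congrArg of (Quotient.sound ?_)
  refine ⟨LinearEquiv.smulOfUnit a, fun x y => ?_⟩
  simp [LinearEquiv.smulOfUnit, Units.smul_def]
  ring

theorem diag_add_diag (a b : Kˣ) :
    diag a + diag b = of (Quotient.mk _ ((QuadSpace.diag a).sum (QuadSpace.diag b))) :=
  let x : QuadClass K := Quotient.mk _ (QuadSpace.diag a)
  let y : QuadClass K := Quotient.mk _ (QuadSpace.diag b)
  (map_add of x y).symm

theorem diag_add_diag_neg [CharZero K] (a : Kˣ) : diag a + diag (-a) = hyp K := by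
  rw [show hyp K = diag 1 + diag (-1) from rfl, diag_add_diag, diag_add_diag]
  refine congrArg of (Quotient.sound ?_)
  have ha : (a : K) ≠ 0 := a.ne_zero
  let f : K × K →ₗ[K] K × K :=
    { toFun := fun z => ((a * (z.1 + z.2) + (z.1 - z.2)) / 2, (a * (z.1 + z.2) - (z.1 - z.2)) / 2)
      map_add' := fun x y => by ext <;> simp <;> ring
      map_smul' := fun c x => by ext <;> simp <;> ring }
  let g : K × K →ₗ[K] K × K :=
    { toFun := fun z => (((z.1 + z.2) / a + (z.1 - z.2)) / 2, ((z.1 + z.2) / a - (z.1 - z.2)) / 2)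
      map_add' := fun x y => by ext <;> simp <;> ring
      map_smul' := fun c x => by ext <;> simp <;> ring }
  refine ⟨LinearEquiv.ofLinearMap f g ?_ ?_, fun x y => ?_⟩
  · ext <;> simp [f, g] <;> field_simp <;> ring
  · ext <;> simp [f, g] <;> field_simp <;> ring
  · change ((1 : Kˣ) : K) • ((f x).1 * (f y).1) + ((-1 : Kˣ) : K) • ((f x).2 * (f y).2) =
      (a : K) • (x.1 * y.1) + ((-a : Kˣ) : K) • (x.2 * y.2)
    simp [f]
    field_simp
    ring

variable [CharZero K]

theorem hyp_mul_diag (a : Kˣ) : hyp K * diag a = hyp K := by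
  have h : hyp K = diag 1 + diag (-1) := rfl
  conv_lhs => rw [h]
  rw [← diag_add_diag_neg a, add_mul, diag_mul_diag, diag_mul_diag]
  simp

theorem hyp_mul_hyp : hyp K * hyp K = 2 * hyp K := by
  have h : hyp K = diag 1 + diag (-1) := rfl
  conv_lhs => enter [2]; rw [h]
  rw [mul_add, hyp_mul_diag, hyp_mul_diag, two_mul]

end GW

/-- The square of the arithmetic multiplicity of an edge of weight `w`. -/
theorem edgeMult_mul_self (K : Type u) [Field K] [CharZero K] (w : ℕ) :
    ∃ p q : ℤ, edgeMult K w * edgeMult K w = p • GW.hyp K + q • GW.diag (1 : Kˣ) ∧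
      q = (if Odd w then 1 else 0) ∧ 2 * p + q = (w : ℤ) ^ 2 := by
  have hh := GW.hyp_mul_hyp (K := K)
  unfold edgeMult
  split_ifs with h
  · obtain ⟨k, rfl⟩ := h
    set u : Kˣ := Units.mk0 (((2 * k + 1 : ℕ)) : K) _
    have hk : (2 * k + 1 - 1) / 2 = k := by omega
    refine ⟨2 * k * k + 2 * k, 1, ?_, rfl, by push_cast; ring⟩
    have h1 := GW.hyp_mul_diag (K := K) u
    have h2 : GW.diag u * GW.diag u = 1 := by rw [GW.diag_mul_diag, GW.diag_mul_self]
    rw [hk, GW.diag_one]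
    simp only [nsmul_eq_mul, zsmul_eq_mul]
    push_cast
    linear_combination (k : GW K) ^ 2 * hh + 2 * (k : GW K) * h1 + h2
  · rw [Nat.not_odd_iff_even] at h
    obtain ⟨k, rfl⟩ := h
    have hk : (k + k) / 2 = k := by omega
    refine ⟨2 * k * k, 0, ?_, rfl, by push_cast; ring⟩
    rw [hk]
    simp only [nsmul_eq_mul, zsmul_eq_mul]
    push_cast
    linear_combination (k : GW K) ^ 2 * hh

theorem edgeMult_one (K : Type u) [Field K] [CharZero K] : edgeMult K 1 = 1 := by
  simp [edgeMult, GW.diag_one]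

theorem FloorDiagram.mult_eq (K : Type u) [Field K] [CharZero K] {d : ℕ} (D : FloorDiagram d) :
    ∃ p q : ℤ, D.mult K = p • GW.hyp K + q • GW.diag (1 : Kˣ) ∧
      q = (D.edges.map fun e => if Odd e.wt then (1 : ℤ) else 0).prod ∧
      2 * p + q = (D.edges.map fun e => (e.wt : ℤ) ^ 2).prod := by
  have hh := GW.hyp_mul_hyp (K := K)
  have key : ∀ E : Multiset (WEdge d), ∃ p q : ℤ,
      (E.map fun e => edgeMult K e.wt * edgeMult K e.wt).prod =
        p • GW.hyp K + q • GW.diag (1 : Kˣ) ∧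
      q = (E.map fun e => if Odd e.wt then (1 : ℤ) else 0).prod ∧
      2 * p + q = (E.map fun e => (e.wt : ℤ) ^ 2).prod := by
    intro E
    induction E using Multiset.induction_on with
    | empty => exact ⟨0, 1, by simp [GW.diag_one], by simp, by simp⟩
    | cons e E ih =>
      obtain ⟨p, q, h1, h2, h3⟩ := ih
      obtain ⟨p', q', h1', h2', h3'⟩ := edgeMult_mul_self K e.wt
      refine ⟨2 * p' * p + p' * q + q' * p, q' * q, ?_, ?_, ?_⟩
      · rw [Multiset.map_cons, Multiset.prod_cons, h1, h1', GW.diag_one]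
        simp only [zsmul_eq_mul]
        push_cast
        linear_combination (p' : GW K) * p * hh
      · rw [Multiset.map_cons, Multiset.prod_cons, h2, h2']
      · rw [Multiset.map_cons, Multiset.prod_cons, ← h3, ← h3']
        ring
  obtain ⟨p, q, h⟩ := key D.edges
  refine ⟨p, q, ?_, h.2⟩
  rw [FloorDiagram.mult, h.1, edgeMult_one]
  simp

/-! ### Eventually polynomial sequences -/

/-- The sequence `u` agrees for large `n` with a polynomial of degree at most `D` whose coefficient
in degree `D` is `c`. -/
def EventuallyPoly (u : ℕ → ℚ) (D : ℕ) (c : ℚ) : Prop :=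
  ∃ p : Polynomial ℚ, p.natDegree ≤ D ∧ p.coeff D = c ∧
    ∀ᶠ n : ℕ in Filter.atTop, u n = p.eval (n : ℚ)

namespace EventuallyPoly

open Polynomial

variable {u v : ℕ → ℚ} {D D' : ℕ} {c c' : ℚ}

theorem congr (hu : EventuallyPoly u D c) (h : ∀ᶠ n : ℕ in Filter.atTop, v n = u n) :
    EventuallyPoly v D c := by
  obtain ⟨p, h1, h2, h3⟩ := hu
  exact ⟨p, h1, h2, by filter_upwards [h, h3] with n a b using a.trans b⟩

theorem const (c : ℚ) : EventuallyPoly (fun _ => c) 0 c :=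
  ⟨C c, by simp, by simp, by simp⟩

theorem add (hu : EventuallyPoly u D c) (hv : EventuallyPoly v D c') :
    EventuallyPoly (fun n => u n + v n) D (c + c') := by
  obtain ⟨p, h1, h2, h3⟩ := hu
  obtain ⟨q, k1, k2, k3⟩ := hv
  exact ⟨p + q, natDegree_add_le_of_degree_le h1 k1, by rw [coeff_add, h2, k2], by
    filter_upwards [h3, k3] with n a b
    rw [eval_add, a, b]⟩

theorem mul (hu : EventuallyPoly u D c) (hv : EventuallyPoly v D' c') :
    EventuallyPoly (fun n => u n * v n) (D + D') (c * c') := by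
  obtain ⟨p, h1, h2, h3⟩ := hu
  obtain ⟨q, k1, k2, k3⟩ := hv
  exact ⟨p * q, natDegree_mul_le_of_le h1 k1, by
    rw [coeff_mul_add_eq_of_natDegree_le h1 k1, h2, k2], by
    filter_upwards [h3, k3] with n a b
    rw [eval_mul, a, b]⟩

theorem const_mul (a : ℚ) (hu : EventuallyPoly u D c) :
    EventuallyPoly (fun n => a * u n) D (a * c) := by
  simpa using (const a).mul hu

theorem of_lt (hu : EventuallyPoly u D c) (h : D < D') : EventuallyPoly u D' 0 := by
  obtain ⟨p, h1, -, h3⟩ := hu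
  exact ⟨p, by omega, coeff_eq_zero_of_natDegree_lt (by omega), h3⟩

theorem zero (D : ℕ) : EventuallyPoly (fun _ => 0) D 0 :=
  ⟨0, by simp, by simp, by simp⟩

theorem sum {ι : Type*} (s : Finset ι) {u : ι → ℕ → ℚ} {c : ι → ℚ}
    (h : ∀ i ∈ s, EventuallyPoly (u i) D (c i)) :
    EventuallyPoly (fun n => ∑ i ∈ s, u i n) D (∑ i ∈ s, c i) := by
  classical
  induction s using Finset.induction_on with
  | empty => simpa using zero D
  | insert a s ha ih =>
    simp only [Finset.sum_insert ha]
    exact (h a (Finset.mem_insert_self _ _)).add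
      (ih fun i hi => h i (Finset.mem_insert_of_mem hi))

theorem coeff_taylor_of_natDegree_le {p : ℚ[X]} (h : p.natDegree ≤ D) (r : ℚ) :
    (taylor r p).coeff D = p.coeff D := by
  rcases h.lt_or_eq with h | rfl
  · rw [coeff_eq_zero_of_natDegree_lt h, coeff_eq_zero_of_natDegree_lt (by simpa using h)]
  · rw [coeff_taylor_natDegree]
    rfl

theorem shift (hu : EventuallyPoly u D c) (k : ℕ) : EventuallyPoly (fun n => u (n + k)) D c := by
  obtain ⟨p, h1, h2, h3⟩ := hu
  refine ⟨taylor (k : ℚ) p, by simpa using h1, by rw [coeff_taylor_of_natDegree_le h1, h2], ?_⟩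
  filter_upwards [(Filter.tendsto_add_atTop_nat k).eventually h3] with n hn
  rw [hn, taylor_eval]
  push_cast
  rfl

theorem of_shift (k : ℕ) (hu : EventuallyPoly (fun n => u (n + k)) D c) :
    EventuallyPoly u D c := by
  obtain ⟨p, h1, h2, h3⟩ := hu
  refine ⟨taylor (-k : ℚ) p, by simpa using h1, by rw [coeff_taylor_of_natDegree_le h1, h2], ?_⟩
  rw [Filter.eventually_atTop] at h3 ⊢
  obtain ⟨N, hN⟩ := h3
  refine ⟨N + k, fun n hn => ?_⟩
  obtain ⟨m, rfl⟩ : ∃ m, n = m + k := ⟨n - k, by omega⟩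
  refine (hN m (by omega)).trans ?_
  rw [taylor_eval]
  push_cast
  ring_nf

theorem exists_antidifference (D : ℕ) : ∀ p : ℚ[X], p.natDegree ≤ D →
    ∃ q : ℚ[X], q.natDegree ≤ D + 1 ∧ q.coeff (D + 1) = p.coeff D / (D + 1) ∧
      ∀ x : ℚ, q.eval (x + 1) - q.eval x = p.eval x := by
  induction D with
  | zero =>
    intro p hp
    refine ⟨C (p.coeff 0) * X, ?_, by simp, fun x => ?_⟩
    · exact natDegree_C_mul_le _ _ |>.trans natDegree_X_le
    · rw [eq_C_of_natDegree_le_zero hp]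
      simp
      ring
  | succ D ih =>
    intro p hp
    set a : ℚ := p.coeff (D + 1) / ((D : ℚ) + 1 + 1) with ha
    set r : ℚ[X] := C a * ((X + 1) ^ (D + 2) - X ^ (D + 2)) with hr
    have hcoeff : ∀ j, r.coeff j = a * (((D + 2).choose j : ℚ) - if j = D + 2 then 1 else 0) := by
      intro j
      rw [hr, coeff_C_mul, coeff_sub, coeff_X_add_one_pow, coeff_X_pow]
    have hD : (p - r).natDegree ≤ D := by
      rw [natDegree_le_iff_coeff_eq_zero]
      intro j hj
      rw [coeff_sub, hcoeff]
      have hD2 : (D : ℚ) + 1 + 1 ≠ 0 := by positivity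
      rcases lt_trichotomy j (D + 2) with h | rfl | h
      · obtain rfl : j = D + 1 := by omega
        rw [if_neg (by omega), Nat.choose_succ_self_right, ha]
        push_cast
        field_simp
        ring
      · rw [coeff_eq_zero_of_natDegree_lt (by omega)]
        simp
      · rw [coeff_eq_zero_of_natDegree_lt (by omega), Nat.choose_eq_zero_of_lt h, if_neg h.ne']
        simp
    obtain ⟨q, h1, -, h3⟩ := ih _ hD
    refine ⟨q + C a * X ^ (D + 2), ?_, ?_, fun x => ?_⟩
    · refine natDegree_add_le_of_degree_le (by omega) ?_
      exact (natDegree_C_mul_le _ _).trans (natDegree_X_pow_le _)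
    · rw [coeff_add, coeff_eq_zero_of_natDegree_lt (by omega), coeff_C_mul, coeff_X_pow, ha]
      simp
    · have := h3 x
      simp [hr] at this ⊢
      linear_combination this

theorem of_difference (hv : EventuallyPoly v D c)
    (h : ∀ᶠ n : ℕ in Filter.atTop, u (n + 1) - u n = v n) :
    EventuallyPoly u (D + 1) (c / (D + 1)) := by
  obtain ⟨p, h1, h2, h3⟩ := hv
  obtain ⟨q, k1, k2, k3⟩ := exists_antidifference D p h1
  have h4 := h.and h3
  rw [Filter.eventually_atTop] at h4
  obtain ⟨N, hN⟩ := h4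
  refine ⟨q + C (u N - q.eval (N : ℚ)), ?_, ?_, ?_⟩
  · exact natDegree_add_le_of_degree_le k1 (by simp)
  · rw [coeff_add, k2, coeff_C_succ, h2, add_zero]
  · filter_upwards [Filter.eventually_ge_atTop N] with n hn
    induction n, hn using Nat.le_induction with
    | base => simp
    | succ n hn ih =>
      have h5 := hN n hn
      have h6 := k3 n
      simp only [eval_add, eval_C] at ih ⊢
      push_cast
      linarith

theorem choose (m : ℕ) :
    EventuallyPoly (fun n => ((n + m).choose m : ℚ)) m (1 / (m.factorial : ℚ)) := by
  induction m with
  | zero => simpa using const 1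
  | succ m ih =>
    have h := of_difference (u := fun n => ((n + (m + 1)).choose (m + 1) : ℚ)) (ih.shift 1)
      (Filter.Eventually.of_forall fun n => by
        have : (n + 1 + (m + 1)).choose (m + 1) =
          (n + 1 + m).choose m + (n + (m + 1)).choose (m + 1) := by
          rw [← add_assoc, Nat.choose_succ_succ, add_right_comm n 1 m, add_assoc n m 1]
        rw [this]
        push_cast
        ring)
    convert h using 1
    rw [Nat.factorial_succ]
    push_cast
    field_simp

end EventuallyPoly

/-- The number of ways to interleave `m` further letters with the ordinary letters in the gap with
index `g`, of which there are `g + 1 - x`. -/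
noncomputable def gapFactor (g x m : ℕ) : ℚ :=
  if x ≤ g + 1 then ((g + 1 - x + m).choose m : ℚ) else 0

theorem EventuallyPoly.gapFactor (R x m : ℕ) :
    EventuallyPoly (fun n => gapFactor (n + R) x m) m (1 / (m.factorial : ℚ)) := by
  refine EventuallyPoly.of_shift x (((EventuallyPoly.choose m).shift (R + 1)).congr ?_)
  refine Filter.Eventually.of_forall fun n => ?_
  rw [_root_.gapFactor, if_pos (by omega)]
  congr 3
  omega

theorem gapFactor_zero_zero (g : ℕ) : gapFactor g 0 0 = 1 := by
  simp [gapFactor]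

/-! ### Weighted counts of configurations with finite range of interaction -/

/-- Data for a weighted count of configurations: every gap `0, 1, 2, …` is filled with an element of
the finite set `S`, and a filling of a gap influences only the gaps at distance less than `range`. -/
structure LocalModel where
  S : Type
  [fintype : Fintype S]
  [decEq : DecidableEq S]
  empty : S
  range : ℕ
  range_pos : 0 < range
  size : S → ℕ
  excess : S → ℕ
  val : S → ℚ
  /-- The weight with which a filling of gap `i` crosses gap `g`. -/
  cross : S → ℕ → ℕ → ℕ
  /-- Whether a filling is allowed in a gap of given distance to the lower end. -/
  lowAdm : S → ℕ → Prop
  /-- Whether a filling is allowed in a gap of given distance to the upper end. -/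
  topAdm : S → ℕ → Prop
  size_empty : size empty = 0
  excess_empty : excess empty = 0
  val_empty : val empty = 1
  size_pos : ∀ s, s ≠ empty → 1 ≤ size s
  size_le : ∀ s, size s ≤ excess s
  cross_add : ∀ s i g n, cross s (n + i) (n + g) = cross s i g
  cross_far : ∀ s i g, i + range ≤ g ∨ g + range ≤ i → cross s i g = 0
  cross_empty : ∀ i g, cross empty i g = 0
  lowAdm_far : ∀ s i, range ≤ i → lowAdm s i
  lowAdm_empty : ∀ i, lowAdm empty i
  topAdm_far : ∀ s i, range ≤ i → topAdm s i
  topAdm_empty : ∀ i, topAdm empty i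

namespace LocalModel

attribute [instance] LocalModel.fintype LocalModel.decEq

variable (𝓜 : LocalModel)

/-- The filling of all gaps given by `M` in the gaps below `n` and by `F` from `n` on. -/
def glue {n : ℕ} (M : Fin n → 𝓜.S) (F : ℕ → 𝓜.S) (i : ℕ) : 𝓜.S :=
  if h : i < n then M ⟨i, h⟩ else F (i - n)

/-- The sequence `F` with `s` put in front. -/
def push (s : 𝓜.S) (F : ℕ → 𝓜.S) : ℕ → 𝓜.S
  | 0 => s
  | i + 1 => F i

/-- The total weight crossing gap `g`. -/
def totalCross (G : ℕ → 𝓜.S) (g : ℕ) : ℕ :=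
  ∑ i ∈ Finset.range (g + 𝓜.range), 𝓜.cross (G i) i g

/-- The contribution of gap `g`. -/
noncomputable def factor (G : ℕ → 𝓜.S) (g : ℕ) : ℚ :=
  gapFactor g (𝓜.totalCross G g) (𝓜.size (G g))

open Classical in
/-- The weighted number of fillings of total excess `e` of the gaps below `n`, given the filling `F`
of the gaps from `n` on, where the contributions of the gaps below `n + range` are counted. -/
noncomputable def partialCount (n e : ℕ) (F : ℕ → 𝓜.S) : ℚ :=
  ∑ M : Fin n → 𝓜.S with ∑ i, 𝓜.excess (M i) = e,
    (∏ i, 𝓜.val (M i)) * (∏ g ∈ Finset.range (n + 𝓜.range), 𝓜.factor (𝓜.glue M F) g) *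
      if ∀ i, 𝓜.lowAdm (𝓜.glue M F i) i then 1 else 0

open Classical in
/-- The admissible fillings of total excess `e` of the gaps below `d`. -/
noncomputable def fillings (d e : ℕ) : Finset (Fin d → 𝓜.S) :=
  Finset.univ.filter fun M => (∑ i, 𝓜.excess (M i) = e) ∧ (∀ i : Fin d, 𝓜.lowAdm (M i) i) ∧
    ∀ i : Fin d, 𝓜.topAdm (M i) (d - 1 - i)

/-- The weighted number of admissible fillings of total excess `e` of the gaps below `d`. -/
noncomputable def count (d e : ℕ) : ℚ :=
  ∑ M ∈ 𝓜.fillings d e,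
    (∏ i, 𝓜.val (M i)) * ∏ g ∈ Finset.range d, 𝓜.factor (𝓜.glue M fun _ => 𝓜.empty) g

variable {𝓜}

theorem mem_fillings {d e : ℕ} {M : Fin d → 𝓜.S} :
    M ∈ 𝓜.fillings d e ↔ (∑ i, 𝓜.excess (M i) = e) ∧ (∀ i : Fin d, 𝓜.lowAdm (M i) i) ∧
      ∀ i : Fin d, 𝓜.topAdm (M i) (d - 1 - i) := by
  simp [fillings]

theorem glue_snoc {n : ℕ} (M : Fin n → 𝓜.S) (s : 𝓜.S) (F : ℕ → 𝓜.S) :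
    𝓜.glue (Fin.snoc (α := fun _ => 𝓜.S) M s) F = 𝓜.glue M (𝓜.push s F) := by
  funext i
  unfold glue
  rcases lt_trichotomy i n with h | rfl | h
  · rw [dif_pos (by omega), dif_pos h]
    exact Fin.snoc_castSucc (α := fun _ => 𝓜.S) s M ⟨i, h⟩
  · rw [dif_pos (by omega), dif_neg (by omega), Nat.sub_self]
    exact Fin.snoc_last (α := fun _ => 𝓜.S) s M
  · rw [dif_neg (by omega), dif_neg (by omega)]
    obtain ⟨k, rfl⟩ : ∃ k, i = n + 1 + k := ⟨i - (n + 1), by omega⟩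
    rw [show n + 1 + k - (n + 1) = k by omega, show n + 1 + k - n = k + 1 by omega]
    rfl

theorem glue_append {n k : ℕ} (M : Fin n → 𝓜.S) (M' : Fin k → 𝓜.S) (F : ℕ → 𝓜.S) :
    𝓜.glue (Fin.append M M') F = 𝓜.glue M (𝓜.glue M' F) := by
  funext i
  unfold glue
  by_cases h : i < n
  · rw [dif_pos (by omega), dif_pos h]
    exact Fin.append_left M M' ⟨i, h⟩
  · rw [dif_neg h]
    obtain ⟨j, rfl⟩ : ∃ j, i = n + j := ⟨i - n, by omega⟩
    by_cases h' : j < k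
    · rw [dif_pos (by omega), dif_pos (by omega)]
      have := Fin.append_right M M' ⟨j, h'⟩
      rw [show (⟨n + j - n, by omega⟩ : Fin k) = ⟨j, h'⟩ from Fin.ext (by simp), ← this]
      rfl
    · rw [dif_neg (by omega), dif_neg (by omega)]
      congr 1
      omega

theorem glue_add {n : ℕ} (M : Fin n → 𝓜.S) (F : ℕ → 𝓜.S) (j : ℕ) :
    𝓜.glue M F (n + j) = F j := by
  simp [glue]

theorem glue_lt {n : ℕ} (M : Fin n → 𝓜.S) (F : ℕ → 𝓜.S) (i : Fin n) :
    𝓜.glue M F i = M i := by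
  simp [glue]

theorem glue_ge {n : ℕ} (M : Fin n → 𝓜.S) (F : ℕ → 𝓜.S) {i : ℕ} (h : n ≤ i) :
    𝓜.glue M F i = F (i - n) :=
  dif_neg (by omega)

/-- The total crossing weight of a gap depends only on the fillings of nearby gaps. -/
theorem totalCross_glue {n : ℕ} (M : Fin n → 𝓜.S) (F : ℕ → 𝓜.S) :
    𝓜.totalCross (𝓜.glue M F) (n + 𝓜.range) = 𝓜.totalCross F 𝓜.range := by
  unfold totalCross
  rw [add_assoc, Finset.sum_range_add, Finset.sum_eq_zero, zero_add]
  · exact Finset.sum_congr rfl fun j _ => by rw [glue_add, 𝓜.cross_add]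
  · intro i hi
    rw [Finset.mem_range] at hi
    exact 𝓜.cross_far _ _ _ (Or.inl (by omega))

theorem partialCount_succ (n e : ℕ) (F : ℕ → 𝓜.S) :
    𝓜.partialCount (n + 1) e F = ∑ s : 𝓜.S with 𝓜.excess s ≤ e,
      𝓜.val s * gapFactor (n + 𝓜.range) (𝓜.totalCross (𝓜.push s F) 𝓜.range)
        (𝓜.size (𝓜.push s F 𝓜.range)) *
          𝓜.partialCount n (e - 𝓜.excess s) (𝓜.push s F) := by
  classical
  unfold partialCount
  rw [Finset.sum_filter, ← (Fin.snocEquiv fun _ => 𝓜.S).sum_comp, Fintype.sum_prod_type,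
    Finset.sum_filter]
  refine Finset.sum_congr rfl fun s _ => ?_
  have hsum : ∀ M : Fin n → 𝓜.S, (∑ i, 𝓜.excess (Fin.snoc (α := fun _ => 𝓜.S) M s i)) =
      (∑ i, 𝓜.excess (M i)) + 𝓜.excess s := fun M => by
    rw [Fin.sum_univ_castSucc]
    simp
  split_ifs with hs
  · rw [Finset.mul_sum, Finset.sum_filter]
    refine Finset.sum_congr rfl fun M _ => ?_
    change (if ∑ i, 𝓜.excess (Fin.snoc (α := fun _ => 𝓜.S) M s i) = e then
      (∏ i, 𝓜.val (Fin.snoc (α := fun _ => 𝓜.S) M s i)) *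
        (∏ g ∈ Finset.range (n + 1 + 𝓜.range),
          𝓜.factor (𝓜.glue (Fin.snoc (α := fun _ => 𝓜.S) M s) F) g) *
        (if ∀ i, 𝓜.lowAdm (𝓜.glue (Fin.snoc (α := fun _ => 𝓜.S) M s) F i) i then 1 else 0)
        else 0) = _
    rw [hsum, glue_snoc]
    have : (∑ i, 𝓜.excess (M i)) + 𝓜.excess s = e ↔
      ∑ i, 𝓜.excess (M i) = e - 𝓜.excess s := by omega
    simp only [this]
    split_ifs
    · rw [Fin.prod_univ_castSucc, show n + 1 + 𝓜.range = n + 𝓜.range + 1 by omega,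
        Finset.prod_range_succ]
      simp only [Fin.snoc_castSucc, Fin.snoc_last]
      rw [show 𝓜.factor (𝓜.glue M (𝓜.push s F)) (n + 𝓜.range) =
        gapFactor (n + 𝓜.range) (𝓜.totalCross (𝓜.push s F) 𝓜.range)
        (𝓜.size (𝓜.push s F 𝓜.range)) by rw [factor, totalCross_glue, glue_add]]
      ring
    · simp
    · rfl
  · refine Finset.sum_eq_zero fun M _ => if_neg ?_
    change ¬ ∑ i, 𝓜.excess (Fin.snoc (α := fun _ => 𝓜.S) M s i) = e
    rw [hsum]
    omega

theorem partialCount_congr (n e : ℕ) {F F' : ℕ → 𝓜.S} (h : ∀ i < 2 * 𝓜.range, F i = F' i) :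
    𝓜.partialCount n e F = 𝓜.partialCount n e F' := by
  classical
  unfold partialCount
  refine Finset.sum_congr rfl fun M _ => ?_
  have hg : ∀ i < n + 2 * 𝓜.range, 𝓜.glue M F i = 𝓜.glue M F' i := fun i hi => by
    unfold glue
    split_ifs
    · rfl
    · exact h _ (by omega)
  have hR := 𝓜.range_pos
  congr 1
  · congr 1
    refine Finset.prod_congr rfl fun g hgr => ?_
    rw [Finset.mem_range] at hgr
    unfold factor totalCross
    rw [hg g (by omega)]
    congr 1
    refine Finset.sum_congr rfl fun i hi => ?_
    rw [Finset.mem_range] at hi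
    rw [hg i (by omega)]
  · congr 1
    refine propext (forall_congr' fun i => ?_)
    by_cases hi : i < n + 2 * 𝓜.range
    · rw [hg i hi]
    · exact iff_of_true (𝓜.lowAdm_far _ _ (by omega)) (𝓜.lowAdm_far _ _ (by omega))

theorem excess_pos {s : 𝓜.S} (hs : s ≠ 𝓜.empty) : 1 ≤ 𝓜.excess s :=
  (𝓜.size_pos s hs).trans (𝓜.size_le s)

theorem totalCross_empty (g : ℕ) : 𝓜.totalCross (fun _ => 𝓜.empty) g = 0 :=
  Finset.sum_eq_zero fun _ _ => 𝓜.cross_empty _ _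

theorem glue_empty (n : ℕ) :
    𝓜.glue (fun _ : Fin n => 𝓜.empty) (fun _ => 𝓜.empty) = fun _ => 𝓜.empty := by
  funext i
  simp [glue]

theorem push_empty : 𝓜.push 𝓜.empty (fun _ => 𝓜.empty) = fun _ => 𝓜.empty := by
  funext i
  cases i <;> rfl

theorem partialCount_zero_empty (n : ℕ) : 𝓜.partialCount n 0 (fun _ => 𝓜.empty) = 1 := by
  classical
  unfold partialCount
  rw [Finset.sum_eq_single_of_mem (fun _ => 𝓜.empty)]
  · rw [glue_empty, if_pos fun i => 𝓜.lowAdm_empty i, Finset.prod_eq_one, Finset.prod_eq_one]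
    · norm_num
    · intro g _
      rw [factor, totalCross_empty, 𝓜.size_empty, gapFactor_zero_zero]
    · intro i _
      exact 𝓜.val_empty
  · simp [𝓜.excess_empty]
  · intro M hM hne
    refine absurd (funext fun i => ?_) hne
    by_contra hi
    have h1 := excess_pos hi
    have h2 := (Finset.mem_filter.1 hM).2
    have h3 := Finset.single_le_sum (f := fun i => 𝓜.excess (M i)) (fun _ _ => Nat.zero_le _)
      (Finset.mem_univ i)
    omega

/-- The total size of the fillings whose gaps still have to contribute. -/
def pendingSize (F : ℕ → 𝓜.S) : ℕ := ∑ i ∈ Finset.range 𝓜.range, 𝓜.size (F i)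

/-- The product of the leading coefficients of the gaps that still have to contribute. -/
noncomputable def pendingCoeff (F : ℕ → 𝓜.S) : ℚ :=
  ∏ i ∈ Finset.range 𝓜.range, 1 / ((𝓜.size (F i)).factorial : ℚ)

theorem pendingSize_push (s : 𝓜.S) (F : ℕ → 𝓜.S) :
    pendingSize (𝓜.push s F) + 𝓜.size (𝓜.push s F 𝓜.range) = 𝓜.size s + pendingSize F := by
  unfold pendingSize
  rw [← Finset.sum_range_succ (fun i => 𝓜.size (𝓜.push s F i)), Finset.sum_range_succ', add_comm]
  rfl

theorem pendingCoeff_push (s : 𝓜.S) (F : ℕ → 𝓜.S) :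
    1 / ((𝓜.size (𝓜.push s F 𝓜.range)).factorial : ℚ) * pendingCoeff (𝓜.push s F) =
      1 / ((𝓜.size s).factorial : ℚ) * pendingCoeff F := by
  unfold pendingCoeff
  rw [mul_comm, ← Finset.prod_range_succ
    (fun i => 1 / ((𝓜.size (𝓜.push s F i)).factorial : ℚ)), Finset.prod_range_succ', mul_comm]
  rfl

theorem pendingSize_empty : pendingSize (fun _ => 𝓜.empty) = 0 := by
  simp [pendingSize, 𝓜.size_empty]

theorem pendingCoeff_empty : pendingCoeff (fun _ => 𝓜.empty) = 1 := by
  simp [pendingCoeff, 𝓜.size_empty]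

variable (𝓜) in
/-- The weighted number of fillings of excess one. -/
noncomputable def unitCount : ℚ := ∑ s : 𝓜.S with 𝓜.excess s = 1, 𝓜.val s

variable (𝓜) in
/-- The leading coefficient of the weighted count of fillings of excess `e`. -/
noncomputable def leadCoeff (e : ℕ) : ℚ := (𝓜.unitCount / 2) ^ e / (e.factorial : ℚ)

theorem partialCount_empty_step (n e : ℕ) :
    𝓜.partialCount (n + 1) e (fun _ => 𝓜.empty) - 𝓜.partialCount n e (fun _ => 𝓜.empty) =
      ∑ s : 𝓜.S with 𝓜.excess s ≤ e ∧ s ≠ 𝓜.empty,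
        𝓜.val s * (gapFactor (n + 𝓜.range)
          (𝓜.totalCross (𝓜.push s fun _ => 𝓜.empty) 𝓜.range) 0 *
          𝓜.partialCount n (e - 𝓜.excess s) (𝓜.push s fun _ => 𝓜.empty)) := by
  have hmem : 𝓜.empty ∈ Finset.univ.filter fun s : 𝓜.S => 𝓜.excess s ≤ e := by
    simp [𝓜.excess_empty]
  rw [partialCount_succ, ← Finset.add_sum_erase _ _ hmem, push_empty, totalCross_empty,
    𝓜.size_empty, gapFactor_zero_zero, 𝓜.val_empty, 𝓜.excess_empty]
  rw [mul_one, one_mul, Nat.sub_zero, add_sub_cancel_left]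
  refine Finset.sum_congr (by ext s; simp [and_comm]) fun s _ => ?_
  obtain ⟨R, hR⟩ : ∃ R, 𝓜.range = R + 1 := ⟨_, (Nat.succ_pred_eq_of_pos 𝓜.range_pos).symm⟩
  have : 𝓜.size (𝓜.push s (fun _ => 𝓜.empty) 𝓜.range) = 0 := by
    rw [hR]
    exact 𝓜.size_empty
  rw [this, mul_assoc]

/-- The weighted number of fillings of given excess is eventually polynomial. -/
theorem eventuallyPoly_partialCount (e : ℕ) : ∀ F : ℕ → 𝓜.S,
    EventuallyPoly (fun n => 𝓜.partialCount n e F) (2 * e + pendingSize F)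
      (𝓜.leadCoeff e * pendingCoeff F) := by
  induction e using Nat.strong_induction_on with
  | _ e ih =>
  have hempty : EventuallyPoly (fun n => 𝓜.partialCount n e fun _ => 𝓜.empty) (2 * e)
      (𝓜.leadCoeff e) := by
    cases e with
    | zero =>
      simp only [partialCount_zero_empty, leadCoeff]
      simpa using EventuallyPoly.const 1
    | succ e =>
      have hd : EventuallyPoly (fun n => ∑ s : 𝓜.S with 𝓜.excess s ≤ e + 1 ∧ s ≠ 𝓜.empty,
          𝓜.val s * (gapFactor (n + 𝓜.range)
            (𝓜.totalCross (𝓜.push s fun _ => 𝓜.empty) 𝓜.range) 0 *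
            𝓜.partialCount n (e + 1 - 𝓜.excess s) (𝓜.push s fun _ => 𝓜.empty))) (2 * e + 1)
          (∑ s : 𝓜.S with 𝓜.excess s ≤ e + 1 ∧ s ≠ 𝓜.empty,
            𝓜.val s * if 𝓜.excess s = 1 then 𝓜.leadCoeff e else 0) := by
        refine EventuallyPoly.sum _ fun s hs => EventuallyPoly.const_mul _ ?_
        obtain ⟨-, hs1, hs2⟩ := Finset.mem_filter.1 hs
        have hpos := excess_pos hs2
        have hle := 𝓜.size_le s
        have hsz := 𝓜.size_pos s hs2
        have h := (EventuallyPoly.gapFactor 𝓜.range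
          (𝓜.totalCross (𝓜.push s fun _ => 𝓜.empty) 𝓜.range) 0).mul
          (ih (e + 1 - 𝓜.excess s) (by omega) (𝓜.push s fun _ => 𝓜.empty))
        have h1 := pendingSize_push s fun _ => 𝓜.empty
        have h2 := pendingCoeff_push s fun _ => 𝓜.empty
        obtain ⟨R, hR⟩ : ∃ R, 𝓜.range = R + 1 :=
          ⟨_, (Nat.succ_pred_eq_of_pos 𝓜.range_pos).symm⟩
        have h0 : 𝓜.size (𝓜.push s (fun _ => 𝓜.empty) 𝓜.range) = 0 := by
          rw [hR]
          exact 𝓜.size_empty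
        rw [h0, pendingSize_empty, add_zero, add_zero] at h1
        rw [h0, pendingCoeff_empty, mul_one, Nat.factorial_zero, Nat.cast_one, div_one,
          one_mul] at h2
        rw [h1, h2] at h
        split_ifs with he
        · have hs1 : 𝓜.size s = 1 := by omega
          rw [he, Nat.add_sub_cancel, hs1] at h
          rw [he, Nat.add_sub_cancel]
          simpa [add_comm] using h
        · exact h.of_lt (by omega)
      have h := hd.of_difference (u := fun n => 𝓜.partialCount n (e + 1) fun _ => 𝓜.empty)
        (Filter.Eventually.of_forall fun n => partialCount_empty_step n (e + 1))
      have hsum : (∑ s : 𝓜.S with 𝓜.excess s ≤ e + 1 ∧ s ≠ 𝓜.empty,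
          𝓜.val s * if 𝓜.excess s = 1 then 𝓜.leadCoeff e else 0) =
          𝓜.unitCount * 𝓜.leadCoeff e := by
        rw [unitCount, Finset.sum_mul, Finset.sum_filter, Finset.sum_filter]
        refine Finset.sum_congr rfl fun s _ => ?_
        by_cases h1 : 𝓜.excess s = 1
        · have : s ≠ 𝓜.empty := fun h => by
            rw [h, 𝓜.excess_empty] at h1
            exact absurd h1 (by norm_num)
          rw [if_pos ⟨by omega, this⟩, if_pos h1, if_pos h1]
        · simp [h1]
      rw [hsum] at h
      have hlead : 𝓜.leadCoeff (e + 1) =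
          𝓜.unitCount * 𝓜.leadCoeff e / (((2 * e + 1 : ℕ) : ℚ) + 1) := by
        rw [leadCoeff, leadCoeff, Nat.factorial_succ]
        push_cast
        field_simp
        ring
      rw [hlead]
      exact h
  have key : ∀ j, j ≤ 2 * 𝓜.range → ∀ F : ℕ → 𝓜.S, (∀ i < 2 * 𝓜.range - j, F i = 𝓜.empty) →
      EventuallyPoly (fun n => 𝓜.partialCount n e F) (2 * e + pendingSize F)
        (𝓜.leadCoeff e * pendingCoeff F) := by
    intro j
    induction j with
    | zero =>
      intro _ F hF
      have hR := 𝓜.range_pos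
      have h1 : pendingSize F = 0 := Finset.sum_eq_zero fun i hi => by
        rw [hF i (by have := Finset.mem_range.1 hi; omega), 𝓜.size_empty]
      have h2 : pendingCoeff F = 1 := Finset.prod_eq_one fun i hi => by
        rw [hF i (by have := Finset.mem_range.1 hi; omega), 𝓜.size_empty]
        simp
      rw [h1, h2, mul_one, add_zero]
      exact hempty.congr (Filter.Eventually.of_forall fun n =>
        partialCount_congr n e fun i hi => hF i (by omega))
    | succ j ihj =>
      intro hj F hF
      refine EventuallyPoly.of_shift 1 ?_
      simp only [partialCount_succ]
      have hmem : 𝓜.empty ∈ Finset.univ.filter fun s : 𝓜.S => 𝓜.excess s ≤ e := by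
        simp [𝓜.excess_empty]
      have hsum : ∑ s : 𝓜.S with 𝓜.excess s ≤ e,
          (if s = 𝓜.empty then 𝓜.leadCoeff e * pendingCoeff F else 0) =
          𝓜.leadCoeff e * pendingCoeff F := by
        rw [Finset.sum_ite_eq' _ 𝓜.empty, if_pos hmem]
      rw [← hsum]
      refine EventuallyPoly.sum _ fun s hs => ?_
      have hs1 := (Finset.mem_filter.1 hs).2
      have h1 := pendingSize_push s F
      have h2 := pendingCoeff_push s F
      have hg := (EventuallyPoly.gapFactor 𝓜.range (𝓜.totalCross (𝓜.push s F) 𝓜.range)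
        (𝓜.size (𝓜.push s F 𝓜.range))).const_mul (𝓜.val s)
      split_ifs with hse
      · have hz := ihj (by omega) (𝓜.push s F) (by
          rintro (_ | i) hi
          · exact hse
          · exact hF i (by omega))
        have h := hg.mul hz
        rw [hse, 𝓜.excess_empty, Nat.sub_zero]
        rw [hse] at h h1 h2
        rw [𝓜.size_empty, zero_add] at h1
        rw [𝓜.size_empty, Nat.factorial_zero, Nat.cast_one, div_one, one_mul] at h2
        convert h using 1
        · omega
        · rw [𝓜.val_empty, ← h2]
          ring
      · have hpos := excess_pos hse
        have hle := 𝓜.size_le s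
        exact (hg.mul (ih (e - 𝓜.excess s) (by omega) (𝓜.push s F))).of_lt (by omega)
  exact fun F => key (2 * 𝓜.range) le_rfl F fun i hi => absurd hi (by omega)

open Classical in
theorem count_add_range (n e : ℕ) :
    𝓜.count (n + 𝓜.range) e = ∑ M : Fin 𝓜.range → 𝓜.S with
      (∀ i : Fin 𝓜.range, 𝓜.topAdm (M i) (𝓜.range - 1 - i)) ∧ ∑ i, 𝓜.excess (M i) ≤ e,
        (∏ i, 𝓜.val (M i)) *
          𝓜.partialCount n (e - ∑ i, 𝓜.excess (M i)) (𝓜.glue M fun _ => 𝓜.empty) := by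
  unfold count fillings partialCount
  rw [Finset.sum_filter, ← (Fin.appendEquiv n 𝓜.range).sum_comp, Fintype.sum_prod_type_right,
    Finset.sum_filter]
  refine Finset.sum_congr rfl fun M' _ => ?_
  have hsum : ∀ M : Fin n → 𝓜.S, (∑ i, 𝓜.excess (Fin.append M M' i)) =
      (∑ i, 𝓜.excess (M i)) + ∑ i, 𝓜.excess (M' i) := fun M => by
    rw [Fin.sum_univ_add]
    simp
  have hprod : ∀ M : Fin n → 𝓜.S, (∏ i, 𝓜.val (Fin.append M M' i)) =
      (∏ i, 𝓜.val (M i)) * ∏ i, 𝓜.val (M' i) := fun M => by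
    rw [Fin.prod_univ_add]
    simp
  have htop : ∀ M : Fin n → 𝓜.S,
      (∀ i : Fin (n + 𝓜.range), 𝓜.topAdm (Fin.append M M' i) (n + 𝓜.range - 1 - i)) ↔
        ∀ i : Fin 𝓜.range, 𝓜.topAdm (M' i) (𝓜.range - 1 - i) := fun M => by
    rw [Fin.forall_fin_add]
    simp only [Fin.append_left, Fin.append_right, Fin.val_castAdd, Fin.val_natAdd]
    refine (and_iff_right fun i => 𝓜.topAdm_far _ _ (by have := i.2; omega)).trans
      (forall_congr' fun i => ?_)
    rw [show n + 𝓜.range - 1 - (n + (i : ℕ)) = 𝓜.range - 1 - i by omega]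
  have hlow : ∀ M : Fin n → 𝓜.S,
      (∀ i : Fin (n + 𝓜.range), 𝓜.lowAdm (Fin.append M M' i) i) ↔
        ∀ i, 𝓜.lowAdm (𝓜.glue M (𝓜.glue M' fun _ => 𝓜.empty) i) i := fun M => by
    rw [← glue_append]
    refine ⟨fun h i => ?_, fun h i => ?_⟩
    · by_cases hi : i < n + 𝓜.range
      · simpa [glue, hi] using h ⟨i, hi⟩
      · simpa [glue, hi] using 𝓜.lowAdm_empty i
    · simpa [glue] using h i
  simp only [Fin.appendEquiv, Equiv.coe_fn_mk, hsum, hprod, htop, hlow, glue_append]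
  by_cases ht : ∀ i : Fin 𝓜.range, 𝓜.topAdm (M' i) (𝓜.range - 1 - i)
  · by_cases he : ∑ i, 𝓜.excess (M' i) ≤ e
    · refine Eq.trans ?_ (if_pos ⟨ht, he⟩).symm
      rw [Finset.mul_sum, Finset.sum_filter]
      refine Finset.sum_congr rfl fun M _ => ?_
      have : (∑ i, 𝓜.excess (M i)) + ∑ i, 𝓜.excess (M' i) = e ↔
        ∑ i, 𝓜.excess (M i) = e - ∑ i, 𝓜.excess (M' i) := by omega
      by_cases h1 : ∑ i, 𝓜.excess (M i) = e - ∑ i, 𝓜.excess (M' i)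
      · by_cases h2 : ∀ i, 𝓜.lowAdm (𝓜.glue M (𝓜.glue M' fun _ => 𝓜.empty) i) i
        · rw [if_pos ⟨this.2 h1, h2, ht⟩, if_pos h1, if_pos h2]
          ring
        · rw [if_neg fun h => h2 h.2.1, if_pos h1, if_neg h2]
          ring
      · rw [if_neg fun h => h1 (this.1 h.1), if_neg h1]
    · refine Eq.trans ?_ (if_neg fun h => he h.2).symm
      exact Finset.sum_eq_zero fun M _ => if_neg fun h => he (by omega)
  · refine Eq.trans ?_ (if_neg fun h => ht h.1).symm
    exact Finset.sum_eq_zero fun M _ => if_neg fun h => ht h.2.2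

theorem eventuallyPoly_count (e : ℕ) :
    EventuallyPoly (fun d => 𝓜.count d e) (2 * e) (𝓜.leadCoeff e) := by
  classical
  refine EventuallyPoly.of_shift 𝓜.range ?_
  simp only [count_add_range]
  have hmem : (fun _ => 𝓜.empty) ∈ Finset.univ.filter fun M : Fin 𝓜.range → 𝓜.S =>
      (∀ i : Fin 𝓜.range, 𝓜.topAdm (M i) (𝓜.range - 1 - i)) ∧ ∑ i, 𝓜.excess (M i) ≤ e := by
    simp [𝓜.excess_empty, 𝓜.topAdm_empty]
  have hsum : ∑ M : Fin 𝓜.range → 𝓜.S with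
      (∀ i : Fin 𝓜.range, 𝓜.topAdm (M i) (𝓜.range - 1 - i)) ∧ ∑ i, 𝓜.excess (M i) ≤ e,
      (if M = (fun _ => 𝓜.empty) then 𝓜.leadCoeff e else 0) = 𝓜.leadCoeff e := by
    rw [Finset.sum_ite_eq' _ (fun _ => 𝓜.empty), if_pos hmem]
  rw [← hsum]
  refine EventuallyPoly.sum _ fun M hM => ?_
  have hle := (Finset.mem_filter.1 hM).2.2
  have h := (eventuallyPoly_partialCount (e - ∑ i, 𝓜.excess (M i))
    (𝓜.glue M fun _ => 𝓜.empty)).const_mul (∏ i, 𝓜.val (M i))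
  split_ifs with hMe
  · subst hMe
    rw [glue_empty] at h ⊢
    simpa [pendingSize_empty, pendingCoeff_empty, 𝓜.val_empty, 𝓜.excess_empty] using h
  · have h1 : pendingSize (𝓜.glue M fun _ => 𝓜.empty) ≤ ∑ i, 𝓜.excess (M i) := by
      rw [pendingSize, ← Fin.sum_univ_eq_sum_range fun i => 𝓜.size (𝓜.glue M (fun _ => 𝓜.empty) i)]
      exact Finset.sum_le_sum fun i _ => by
        rw [glue_lt]
        exact 𝓜.size_le _
    have h2 : 1 ≤ ∑ i, 𝓜.excess (M i) := by
      obtain ⟨i, hi⟩ := Function.ne_iff.1 hMe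
      exact (excess_pos hi).trans (Finset.single_le_sum (f := fun i => 𝓜.excess (M i))
        (fun _ _ => Nat.zero_le _) (Finset.mem_univ i))
    exact h.of_lt (by omega)

end LocalModel

/-! ### Interleaving a list with copies of a letter -/

/-- The lists obtained from `l` by inserting `c` copies of `o`. -/
def shuffle {α : Type*} [DecidableEq α] (o : α) : ℕ → List α → Finset (List α)
  | 0, l => {l}
  | c + 1, [] => {List.replicate (c + 1) o}
  | c + 1, x :: l => (shuffle o c (x :: l)).image (List.cons o) ∪
      (shuffle o (c + 1) l).image (List.cons x)

theorem mem_shuffle {α : Type*} [DecidableEq α] {o : α} (L : List α) : ∀ {l : List α} {c : ℕ},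
    o ∉ l → (L ∈ shuffle o c l ↔ L.filter (· ≠ o) = l ∧ L.count o = c) := by
  induction L with
  | nil =>
    intro l c _
    rcases c with _ | c
    · simp [shuffle, eq_comm]
    · rcases l with _ | ⟨x, l⟩ <;> simp [shuffle, List.replicate_succ]
  | cons y L ih =>
    intro l c ho
    rcases c with _ | c
    · rw [shuffle, Finset.mem_singleton]
      constructor
      · rintro rfl
        exact ⟨List.filter_eq_self.2 fun a ha => by
          simpa using fun h : a = o => ho (h ▸ ha), List.count_eq_zero.2 ho⟩
      · rintro ⟨h1, h2⟩
        rw [← h1, List.filter_eq_self.2]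
        intro a ha
        simpa using fun h : a = o => List.count_eq_zero.1 h2 (h ▸ ha)
    · rcases l with _ | ⟨x, l⟩
      · rw [shuffle, Finset.mem_singleton]
        constructor
        · intro h
          rw [h]
          simp
        · rintro ⟨h1, h2⟩
          refine List.eq_replicate_iff.2 ⟨?_, fun b hb => ?_⟩
          · rw [← h2, eq_comm, List.count_eq_length]
            intro b hb
            by_contra hne
            exact List.filter_eq_nil_iff.1 h1 b hb (by simpa using Ne.symm hne)
          · by_contra hne
            exact List.filter_eq_nil_iff.1 h1 b hb (by simpa using hne)
      · have hxo : x ≠ o := fun h => ho (h ▸ List.mem_cons_self)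
        have hl : o ∉ l := fun h => ho (List.mem_cons_of_mem _ h)
        have ho' : o ∉ x :: l := ho
        rw [shuffle, Finset.mem_union, Finset.mem_image, Finset.mem_image]
        by_cases hy : y = o
        · subst hy
          simp only [List.cons.injEq, true_and, exists_eq_right, ih ho']
          simp [hxo]
        · have : (∃ a ∈ shuffle o (c + 1) l, x :: a = y :: L) ↔ x = y ∧ L ∈ shuffle o (c + 1) l := by
            constructor
            · rintro ⟨a, ha, h⟩
              rw [List.cons.injEq] at h
              exact ⟨h.1, h.2 ▸ ha⟩
            · rintro ⟨rfl, h⟩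
              exact ⟨L, h, rfl⟩
          rw [this, ih hl]
          have h2 : ¬ ∃ a ∈ shuffle o c (x :: l), o :: a = y :: L := by
            rintro ⟨a, -, h⟩
            exact hy (List.cons.inj h).1.symm
          simp only [h2, false_or]
          rw [List.filter_cons_of_pos (by simpa using hy), List.count_cons_of_ne hy,
            List.cons.injEq, and_assoc, eq_comm (a := x)]

theorem card_shuffle {α : Type*} [DecidableEq α] {o : α} (c : ℕ) (l : List α) (ho : o ∉ l) :
    (shuffle o c l).card = (c + l.length).choose l.length := by
  induction c generalizing l with
  | zero => simp [shuffle]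
  | succ c ihc =>
    induction l with
    | nil => simp [shuffle]
    | cons x l ihl =>
      have hxo : x ≠ o := fun h => ho (h ▸ List.mem_cons_self)
      have hl : o ∉ l := fun h => ho (List.mem_cons_of_mem _ h)
      rw [shuffle, Finset.card_union_of_disjoint, Finset.card_image_of_injective _
        List.cons_injective, Finset.card_image_of_injective _ List.cons_injective, ihc _ ho, ihl hl]
      · rw [List.length_cons, show c + 1 + (l.length + 1) = (c + 1 + l.length) + 1 by ring,
          Nat.choose_succ_succ, add_comm, show c + (l.length + 1) = c + 1 + l.length by ring]
      · rw [Finset.disjoint_left]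
        intro a ha hb
        rw [Finset.mem_image] at ha hb
        obtain ⟨a', -, rfl⟩ := ha
        obtain ⟨b', -, h⟩ := hb
        exact hxo (List.cons.inj h).1

/-! ### Segments -/

/-- An edge of a floor diagram, seen from the gap between two consecutive white vertices in which
its black vertex lies: it passes `left` further gaps on the side of its source and `right` further
gaps on the side of its target. -/
@[ext]
structure Seg where
  left : ℕ
  right : ℕ
  weight : ℕ

noncomputable instance Seg.instDecidableEq : DecidableEq Seg := Classical.decEq _

namespace Seg

/-- The sum of the weights over all gaps that are crossed. -/
def area (x : Seg) : ℕ := x.weight * (x.left + x.right + 1)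

/-- The contribution of a segment to the cogenus. -/
def excess (x : Seg) : ℕ := x.area - 1

/-- The weight with which a segment in gap `i` crosses gap `g`, where gaps are numbered from the
target side. -/
def cross (x : Seg) (i g : ℕ) : ℕ := if g ≤ i + x.left ∧ i ≤ g + x.right then x.weight else 0

/-- The segment of weight one that crosses a single gap. -/
def ordinary : Seg := ⟨0, 0, 1⟩

/-- The total excess of a list of segments. -/
def listExcess (L : List Seg) : ℕ := (L.map excess).sum

/-- The total weight with which a list of segments in gap `i` crosses gap `g`. -/
def listCross (L : List Seg) (i g : ℕ) : ℕ := (L.map fun x => x.cross i g).sum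

/-- The product of the weight function over a list of segments. -/
def listVal (f : ℕ → ℚ) (L : List Seg) : ℚ := (L.map fun x => f x.weight).prod

theorem weight_pos {x : Seg} (h : 2 ≤ x.area) : 1 ≤ x.weight := by
  rw [Nat.one_le_iff_ne_zero]
  intro h0
  simp [area, h0] at h

theorem bounds_of_area {x : Seg} (h : 2 ≤ x.area) :
    x.left ≤ x.excess ∧ x.right ≤ x.excess ∧ x.weight ≤ x.excess + 1 := by
  have hw := weight_pos h
  have h1 : x.left + x.right + 1 ≤ x.area := Nat.le_mul_of_pos_left _ hw
  have h2 : x.weight ≤ x.area := Nat.le_mul_of_pos_right _ (Nat.succ_pos _)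
  unfold excess
  omega

theorem excess_le_listExcess {L : List Seg} {x : Seg} (h : x ∈ L) : x.excess ≤ listExcess L :=
  List.single_le_sum (fun _ _ => Nat.zero_le _) _ (List.mem_map_of_mem h)

theorem length_le_listExcess {L : List Seg} (h : ∀ x ∈ L, 2 ≤ x.area) :
    L.length ≤ listExcess L := by
  induction L with
  | nil => simp
  | cons x L ih =>
    have h1 := h x List.mem_cons_self
    have h2 := ih fun y hy => h y (List.mem_cons_of_mem _ hy)
    simp only [listExcess, List.map_cons, List.sum_cons, List.length_cons] at h2 ⊢
    have : 1 ≤ x.excess := by unfold excess; omega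
    omega

theorem ne_ordinary {x : Seg} (h : 2 ≤ x.area) : x ≠ ordinary := by
  rintro rfl
  simp [ordinary, area] at h

theorem two_le_area {x : Seg} (hw : 1 ≤ x.weight) (h : x ≠ ordinary) : 2 ≤ x.area := by
  by_contra hlt
  have h1 : x.left + x.right + 1 ≤ x.area := Nat.le_mul_of_pos_left _ hw
  have h2 : x.weight ≤ x.area := Nat.le_mul_of_pos_right _ (Nat.succ_pos _)
  refine h (Seg.ext ?_ ?_ ?_) <;> simp only [ordinary] <;> omega

theorem listExcess_filter (L : List Seg) :
    listExcess (L.filter (· ≠ ordinary)) = listExcess L := by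
  induction L with
  | nil => rfl
  | cons x L ih =>
    by_cases h : x = ordinary
    · subst h
      rw [List.filter_cons_of_neg (by simp), ih]
      simp [listExcess, excess, area, ordinary]
    · rw [List.filter_cons_of_pos (by simpa using h)]
      simp only [listExcess, List.map_cons, List.sum_cons] at ih ⊢
      rw [ih]

theorem listCross_filter (L : List Seg) (i g : ℕ) :
    listCross L i g = listCross (L.filter (· ≠ ordinary)) i g +
      if i = g then L.count ordinary else 0 := by
  induction L with
  | nil => simp [listCross]
  | cons x L ih =>
    by_cases h : x = ordinary
    · subst h
      rw [List.filter_cons_of_neg (by simp), List.count_cons_self]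
      have h1 : ordinary.cross i g = if i = g then 1 else 0 := by
        simp only [cross, ordinary, add_zero]
        refine if_congr ?_ rfl rfl
        omega
      have h2 : listCross (ordinary :: L) i g = ordinary.cross i g + listCross L i g := rfl
      rw [h2, ih, h1]
      split_ifs <;> omega
    · rw [List.filter_cons_of_pos (by simpa using h), List.count_cons_of_ne h]
      have h2 : ∀ L, listCross (x :: L) i g = x.cross i g + listCross L i g := fun _ => rfl
      rw [h2, h2, ih, add_assoc]

theorem listVal_filter {f : ℕ → ℚ} (hf : f 1 = 1) (L : List Seg) :
    listVal f (L.filter (· ≠ ordinary)) = listVal f L := by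
  induction L with
  | nil => rfl
  | cons x L ih =>
    by_cases h : x = ordinary
    · subst h
      rw [List.filter_cons_of_neg (by simp), ih]
      simp [listVal, ordinary, hf]
    · rw [List.filter_cons_of_pos (by simpa using h)]
      simp only [listVal, List.map_cons, List.prod_cons] at ih ⊢
      rw [ih]

end Seg

/-- The lists of non-ordinary segments of total excess at most `δ`. -/
def segFillings (δ : ℕ) : Set (List Seg) :=
  {L | (∀ x ∈ L, 2 ≤ x.area) ∧ Seg.listExcess L ≤ δ}

theorem finite_segFillings (δ : ℕ) : (segFillings δ).Finite := by
  let T : Set Seg := {x | x.left ≤ δ ∧ x.right ≤ δ ∧ x.weight ≤ δ + 1}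
  have hT : T.Finite := by
    refine Set.Finite.subset (((Set.finite_Iic δ).prod ((Set.finite_Iic δ).prod
      (Set.finite_Iic (δ + 1)))).image fun p => (⟨p.1, p.2.1, p.2.2⟩ : Seg)) ?_
    rintro x ⟨h1, h2, h3⟩
    exact ⟨(x.left, x.right, x.weight), ⟨h1, h2, h3⟩, rfl⟩
  have : Finite T := hT
  refine Set.Finite.subset ((List.finite_length_le T δ).image (List.map Subtype.val)) ?_
  rintro L ⟨h1, h2⟩
  have hmem : ∀ x ∈ L, x ∈ T := fun x hx => by
    have h3 := Seg.bounds_of_area (h1 x hx)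
    have h4 := Seg.excess_le_listExcess hx
    exact ⟨by omega, by omega, by omega⟩
  refine ⟨L.attach.map fun x => ⟨x.1, hmem _ x.2⟩, ?_, ?_⟩
  · have := Seg.length_le_listExcess h1
    simp only [Set.mem_ofPred_eq, List.length_map, List.length_attach]
    omega
  · simp [List.map_map, Function.comp_def]

/-- The local model whose fillings are lists of non-ordinary segments. -/
noncomputable def segModel (f : ℕ → ℚ) (δ : ℕ) : LocalModel where
  S := segFillings δ
  fintype := (finite_segFillings δ).fintype
  decEq := Classical.decEq _
  empty := ⟨[], by simp [segFillings, Seg.listExcess]⟩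
  range := δ + 1
  range_pos := Nat.succ_pos _
  size L := L.1.length
  excess L := Seg.listExcess L.1
  val L := Seg.listVal f L.1
  cross L := Seg.listCross L.1
  lowAdm L i := ∀ x ∈ L.1, x.right ≤ i
  topAdm L j := ∀ x ∈ L.1, x.left ≤ j ∧ (x.left = j → x.weight = 1)
  size_empty := rfl
  excess_empty := rfl
  val_empty := rfl
  size_pos L hL := by
    rw [Nat.one_le_iff_ne_zero]
    exact fun h => hL (Subtype.ext (List.length_eq_zero_iff.1 h))
  size_le L := Seg.length_le_listExcess L.2.1
  cross_add L i g n := by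
    unfold Seg.listCross Seg.cross
    congr 1
    refine List.map_congr_left fun x _ => if_congr ?_ rfl rfl
    omega
  cross_far L i g h := by
    refine List.sum_eq_zero fun y hy => ?_
    obtain ⟨x, hx, rfl⟩ := List.mem_map.1 hy
    have h1 := Seg.bounds_of_area (L.2.1 x hx)
    have h2 := Seg.excess_le_listExcess hx
    have h3 := L.2.2
    exact if_neg (by omega)
  cross_empty _ _ := rfl
  lowAdm_far L i h x hx := by
    have h1 := Seg.bounds_of_area (L.2.1 x hx)
    have h2 := Seg.excess_le_listExcess hx
    have h3 := L.2.2
    omega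
  lowAdm_empty _ x hx := absurd hx List.not_mem_nil
  topAdm_far L i h x hx := by
    have h1 := Seg.bounds_of_area (L.2.1 x hx)
    have h2 := Seg.excess_le_listExcess hx
    have h3 := L.2.2
    omega
  topAdm_empty _ x hx := absurd hx List.not_mem_nil

theorem unitCount_segModel {f : ℕ → ℚ} (hf : f 1 = 1) {δ : ℕ} (hδ : 1 ≤ δ) :
    (segModel f δ).unitCount = f 2 + 2 := by
  have hmem : ∀ x : Seg, x.area = 2 → [x] ∈ segFillings δ := fun x hx =>
    ⟨by simp [hx], by simpa [Seg.listExcess, Seg.excess, hx] using hδ⟩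
  let t : Seg → segFillings δ := fun x =>
    if h : x.area = 2 then ⟨[x], hmem x h⟩ else ⟨[], by simp [segFillings, Seg.listExcess]⟩
  let s : Seg → (segModel f δ).S := t
  have hs : ∀ x : Seg, x.area = 2 → (s x).1 = [x] := fun x h => congrArg Subtype.val (dif_pos h)
  have h1 : Finset.univ.filter (fun t : (segModel f δ).S => (segModel f δ).excess t = 1) =
      ({⟨0, 0, 2⟩, ⟨1, 0, 1⟩, ⟨0, 1, 1⟩} : Finset Seg).image s := by
    ext t
    simp only [Finset.mem_filter, Finset.mem_univ, true_and, Finset.mem_image]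
    constructor
    · intro ht
      change Seg.listExcess t.1 = 1 at ht
      have hlen := Seg.length_le_listExcess t.2.1
      obtain ⟨x, hx⟩ : ∃ x, t.1 = [x] := by
        rw [← List.length_eq_one_iff]
        rcases Nat.lt_or_ge 0 t.1.length with h | h
        · omega
        · rw [List.length_eq_zero_iff.1 (Nat.le_zero.1 h)] at ht
          exact absurd ht (by simp [Seg.listExcess])
      have hx2 := t.2.1 x (by rw [hx]; exact List.mem_singleton_self x)
      have hxa : x.area = 2 := by
        rw [hx] at ht
        simp only [Seg.listExcess, Seg.excess, List.map_cons, List.map_nil, List.sum_cons,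
          List.sum_nil] at ht
        omega
      refine ⟨x, ?_, Subtype.ext ((hs x hxa).trans hx.symm)⟩
      have hb := Seg.bounds_of_area hx2
      have hw := Seg.weight_pos hx2
      have he : x.excess = 1 := by unfold Seg.excess; omega
      obtain ⟨l, r, w⟩ := x
      simp only [he, Seg.area] at hb hxa hw
      obtain ⟨hl, hr, hw2⟩ := hb
      interval_cases l <;> interval_cases r <;> interval_cases w <;> simp_all
    · rintro ⟨x, hx, rfl⟩
      have hxa : x.area = 2 := by
        simp only [Finset.mem_insert, Finset.mem_singleton] at hx
        rcases hx with rfl | rfl | rfl <;> rfl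
      change Seg.listExcess (s x).1 = 1
      rw [hs x hxa]
      simp [Seg.listExcess, Seg.excess, hxa]
  rw [LocalModel.unitCount, h1, Finset.sum_image]
  · have hv : ∀ x : Seg, x.area = 2 → (segModel f δ).val (s x) = f x.weight := fun x hx => by
      change Seg.listVal f (s x).1 = _
      rw [hs x hx]
      simp [Seg.listVal]
    rw [Finset.sum_insert (by simp), Finset.sum_insert (by simp), Finset.sum_singleton,
      hv _ rfl, hv _ rfl, hv _ rfl, hf]
    norm_num
  · intro x hx y hy hxy
    have hxa : x.area = 2 := by
      simp only [Finset.coe_insert, Finset.coe_singleton, Set.mem_insert_iff,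
        Set.mem_singleton_iff] at hx
      rcases hx with rfl | rfl | rfl <;> rfl
    have hya : y.area = 2 := by
      simp only [Finset.coe_insert, Finset.coe_singleton, Set.mem_insert_iff,
        Set.mem_singleton_iff] at hy
      rcases hy with rfl | rfl | rfl <;> rfl
    have := congrArg Subtype.val hxy
    rw [hs x hxa, hs y hya] at this
    exact (List.cons.inj this).1

/-! ### Configurations of segments -/

/-- The configurations of segments in `d` gaps that encode marked floor diagrams of degree `d` and
cogenus `δ`. -/
structure IsConfig (d δ : ℕ) (ω : Fin d → List Seg) : Prop where
  seg : ∀ i : Fin d, ∀ x ∈ ω i, 1 ≤ x.weight ∧ x.right ≤ i ∧ x.left ≤ d - 1 - i ∧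
    (x.left = d - 1 - i → x.weight = 1)
  cross : ∀ g : Fin d, ∑ i : Fin d, Seg.listCross (ω i) i g = g + 1
  excess : ∑ i, Seg.listExcess (ω i) = δ

theorem totalCross_segModel (f : ℕ → ℚ) {d δ : ℕ} (M : Fin d → segFillings δ) (g : ℕ) :
    (segModel f δ).totalCross ((segModel f δ).glue M fun _ => (segModel f δ).empty) g =
      ∑ i : Fin d, Seg.listCross (M i).1 i g := by
  let 𝓜 := segModel f δ
  let h : ℕ → ℕ := fun i => 𝓜.cross (𝓜.glue M (fun _ => 𝓜.empty) i) i g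
  have h1 : ∑ i : Fin d, Seg.listCross (M i).1 i g = ∑ i ∈ Finset.range d, h i := by
    rw [← Fin.sum_univ_eq_sum_range]
    exact Finset.sum_congr rfl fun i _ =>
      (congrArg (fun s => 𝓜.cross s i g) (LocalModel.glue_lt (𝓜 := 𝓜) M _ i)).symm
  have h2 : ∀ i, d ≤ i → h i = 0 := fun i hi =>
    (congrArg (fun s => 𝓜.cross s i g) (LocalModel.glue_ge (𝓜 := 𝓜) M _ hi)).trans
      (𝓜.cross_empty _ _)
  have h3 : ∀ i, g + 𝓜.range ≤ i → h i = 0 := fun i hi => 𝓜.cross_far _ _ _ (Or.inr hi)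
  rw [h1]
  change ∑ i ∈ Finset.range (g + 𝓜.range), h i = _
  rw [Finset.sum_subset (Finset.range_subset_range.2 (le_max_left (g + 𝓜.range) d))
    (fun i _ hi => h3 i (by simpa using hi)),
    Finset.sum_subset (Finset.range_subset_range.2 (le_max_right (g + 𝓜.range) d))
    (fun i _ hi => h2 i (by simpa using hi))]

theorem exists_configs (d δ : ℕ) : ∃ Ω : Finset (Fin d → List Seg),
    (∀ ω, ω ∈ Ω ↔ IsConfig d δ ω) ∧ ∀ f : ℕ → ℚ, f 1 = 1 →
      ∑ ω ∈ Ω, ∏ i, Seg.listVal f (ω i) = (segModel f δ).count d δ := by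
  classical
  let x : (Fin d → segFillings δ) → ℕ → ℕ := fun M g => ∑ i : Fin d, Seg.listCross (M i).1 i g
  let ok : (Fin d → segFillings δ) → Prop := fun M =>
    (∑ i, Seg.listExcess (M i).1 = δ) ∧ (∀ i : Fin d, ∀ y ∈ (M i).1, y.right ≤ i) ∧
      ∀ i : Fin d, ∀ y ∈ (M i).1, y.left ≤ d - 1 - i ∧ (y.left = d - 1 - i → y.weight = 1)
  let fib : (Fin d → segFillings δ) → Finset (Fin d → List Seg) := fun M =>
    if ∀ g : Fin d, x M g ≤ g + 1 then
      Fintype.piFinset fun i => shuffle Seg.ordinary (i + 1 - x M i) (M i).1 else ∅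
  have hord : ∀ (M : Fin d → segFillings δ) (i : Fin d), Seg.ordinary ∉ (M i).1 := fun M i h =>
    Seg.ne_ordinary ((M i).2.1 _ h) rfl
  have hfib : ∀ (M : Fin d → segFillings δ) (ω : Fin d → List Seg), ω ∈ fib M ↔
      (∀ g : Fin d, x M g ≤ g + 1) ∧ ∀ i, (ω i).filter (· ≠ Seg.ordinary) = (M i).1 ∧
        (ω i).count Seg.ordinary = i + 1 - x M i := fun M ω => by
    simp only [fib]
    split_ifs with h
    · simp only [h, implies_true, true_and, Fintype.mem_piFinset, mem_shuffle _ (hord M _)]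
    · simp [h]
  let fin := (finite_segFillings δ).fintype
  refine ⟨(Finset.univ.filter ok).biUnion fib, fun ω => ?_, fun f hf => ?_⟩
  · rw [Finset.mem_biUnion]
    have hcross : ∀ (M : Fin d → segFillings δ),
        (∀ i, (ω i).filter (· ≠ Seg.ordinary) = (M i).1) → ∀ g : Fin d,
        ∑ i : Fin d, Seg.listCross (ω i) i g = x M g + (ω g).count Seg.ordinary := by
      intro M hM g
      simp only [Seg.listCross_filter (ω _), hM, Finset.sum_add_distrib, Fin.val_inj,
        Finset.sum_ite_eq', Finset.mem_univ, if_true, x]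
    constructor
    · rintro ⟨M, hM, hω⟩
      obtain ⟨hex, hlow, htop⟩ := (Finset.mem_filter.1 hM).2
      obtain ⟨hx, hω⟩ := (hfib M ω).1 hω
      refine ⟨fun i y hy => ?_, fun g => ?_, ?_⟩
      · by_cases hyo : y = Seg.ordinary
        · subst hyo
          simp [Seg.ordinary]
        · have hyM : y ∈ (M i).1 := by
            rw [← (hω i).1]
            exact List.mem_filter.2 ⟨hy, by simpa using hyo⟩
          exact ⟨Seg.weight_pos ((M i).2.1 y hyM), hlow i y hyM, htop i y hyM⟩
      · rw [hcross M (fun i => (hω i).1), (hω g).2]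
        have := hx g
        omega
      · rw [← hex]
        exact Finset.sum_congr rfl fun i _ => by rw [← Seg.listExcess_filter, (hω i).1]
    · rintro ⟨hseg, hcr, hex⟩
      have hM : ∀ i, (ω i).filter (· ≠ Seg.ordinary) ∈ segFillings δ := fun i => by
        refine ⟨fun y hy => ?_, ?_⟩
        · obtain ⟨hy, hyo⟩ := List.mem_filter.1 hy
          exact Seg.two_le_area (hseg i y hy).1 (by simpa using hyo)
        · rw [Seg.listExcess_filter, ← hex]
          exact Finset.single_le_sum (f := fun i => Seg.listExcess (ω i))
            (fun _ _ => Nat.zero_le _) (Finset.mem_univ i)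
      have hmem : ∀ i, ∀ y ∈ (ω i).filter (· ≠ Seg.ordinary), y ∈ ω i := fun i y hy =>
        (List.mem_filter.1 hy).1
      have hc := hcross (fun i => ⟨_, hM i⟩) fun _ => rfl
      refine ⟨fun i => ⟨_, hM i⟩, Finset.mem_filter.2 ⟨Finset.mem_univ _, ?_, ?_, ?_⟩, ?_⟩
      · exact (Finset.sum_congr rfl fun i _ => Seg.listExcess_filter _).trans hex
      · exact fun i y hy => (hseg i y (hmem i y hy)).2.1
      · exact fun i y hy => (hseg i y (hmem i y hy)).2.2
      · rw [hfib]
        refine ⟨fun g => ?_, fun i => ⟨rfl, ?_⟩⟩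
        · have := hc g
          rw [hcr] at this
          omega
        · have := hc i
          rw [hcr] at this
          omega
  · rw [Finset.sum_biUnion]
    · rw [LocalModel.count]
      refine Finset.sum_congr ?_ fun M _ => ?_
      · ext M
        exact (Finset.mem_filter.trans (and_iff_right (Finset.mem_univ M))).trans
          (LocalModel.mem_fillings (𝓜 := segModel f δ)).symm
      · have hval : ∀ ω ∈ fib M, ∏ i, Seg.listVal f (ω i) = ∏ i, Seg.listVal f (M i).1 := by
          intro ω hω
          refine Finset.prod_congr rfl fun i _ => ?_
          rw [← Seg.listVal_filter hf, (((hfib M ω).1 hω).2 i).1]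
        rw [Finset.sum_congr rfl hval, Finset.sum_const, nsmul_eq_mul, mul_comm]
        congr 1
        rw [← Fin.prod_univ_eq_prod_range]
        have hfac : ∀ g : Fin d, (segModel f δ).factor
            ((segModel f δ).glue M fun _ => (segModel f δ).empty) g =
            gapFactor g (x M g) (M g).1.length := fun g =>
          congrArg₂ (gapFactor g) (totalCross_segModel f M g)
            (congrArg (segModel f δ).size (LocalModel.glue_lt (𝓜 := segModel f δ) M _ g))
        simp only [hfac, fib]
        split_ifs with h
        · rw [Fintype.card_piFinset]
          push_cast
          refine Finset.prod_congr rfl fun i _ => ?_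
          rw [card_shuffle _ _ (hord M i), gapFactor, if_pos (h i)]
        · push Not at h
          obtain ⟨g, hg⟩ := h
          rw [Finset.prod_eq_zero (Finset.mem_univ g)]
          · simp
          · rw [gapFactor, if_neg (by omega)]
    · intro M _ M' _ hne
      rw [Function.onFun, Finset.disjoint_left]
      intro ω h h'
      refine hne (funext fun i => Subtype.ext ?_)
      rw [← (((hfib M ω).1 h).2 i).1, ← (((hfib M' ω).1 h').2 i).1]

/-! ### Markings as words -/

theorem List.exists_ofFn_eq {α : Type*} {n : ℕ} {l : List α} (h : l.length = n) :
    ∃ g : Fin n → α, List.ofFn g = l := by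
  subst h
  exact ⟨l.get, List.ofFn_get l⟩

theorem Multiset.exists_map_univ_eq {α : Type*} {n : ℕ} {s : Multiset α} (h : s.card = n) :
    ∃ g : Fin n → α, Finset.univ.val.map g = s := by
  induction s using Quotient.inductionOn with
  | h l =>
    obtain ⟨g, hg⟩ := List.exists_ofFn_eq (l := l) h
    exact ⟨g, by rw [Fin.univ_val_map, hg]; rfl⟩

theorem exists_equiv_of_map_univ_eq {α β γ : Type*} [Fintype α] [Fintype β] {f : α → γ} {g : β → γ}
    (h : Finset.univ.val.map f = Finset.univ.val.map g) : ∃ e : α ≃ β, ∀ a, g (e a) = f a := by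
  classical
  have hc : ∀ c, Fintype.card {a // f a = c} = Fintype.card {b // g b = c} := fun c => by
    have := congrArg (Multiset.count c) h
    rw [Multiset.count_map, Multiset.count_map] at this
    rw [Fintype.card_subtype, Fintype.card_subtype, Finset.card_def, Finset.card_def,
      Finset.filter_val, Finset.filter_val]
    simpa only [eq_comm] using this
  let F : ∀ c, {a // f a = c} ≃ {b // g b = c} := fun c => Fintype.equivOfCardEq (hc c)
  exact ⟨Equiv.ofFiberEquiv F, Equiv.ofFiberEquiv_map F⟩

/-- A list of letters of two kinds is cut into pieces by the letters of the first kind. -/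
theorem List.exists_flatMap_eq {α β : Type*} [DecidableEq α] (L : List (α ⊕ β)) :
    (L.filterMap Sum.getLeft?).Nodup → ∃ (W : α → List β) (t : List β),
      L = (L.filterMap Sum.getLeft?).flatMap (fun k => (W k).map Sum.inr ++ [Sum.inl k]) ++
        t.map Sum.inr := by
  induction L with
  | nil => exact fun _ => ⟨fun _ => [], [], rfl⟩
  | cons x L ih =>
    rcases x with a | b
    · intro h
      have hcons : (Sum.inl a :: L).filterMap Sum.getLeft? = a :: L.filterMap Sum.getLeft? := rfl
      rw [hcons] at h ⊢
      obtain ⟨ha, hn⟩ := List.nodup_cons.1 h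
      obtain ⟨W, t, hW⟩ := ih hn
      refine ⟨Function.update W a [], t, ?_⟩
      rw [List.flatMap_cons, Function.update_self, List.map_nil, List.nil_append, List.append_assoc,
        List.singleton_append]
      congr 1
      conv_lhs => rw [hW]
      congr 1
      refine List.flatMap_congr fun k hk => ?_
      have hne : k ≠ a := fun h => ha (h ▸ hk)
      rw [Function.update_of_ne hne]
    · intro h
      rw [List.filterMap_cons_none rfl] at h ⊢
      obtain ⟨W, t, hW⟩ := ih h
      rcases hl : L.filterMap Sum.getLeft? with _ | ⟨a, l⟩
      · rw [hl] at hW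
        exact ⟨W, b :: t, by rw [hW]; rfl⟩
      · rw [hl] at hW h
        have ha := (List.nodup_cons.1 h).1
        refine ⟨Function.update W a (b :: W a), t, ?_⟩
        have hl' : l.flatMap (fun k => (Function.update W a (b :: W a) k).map Sum.inr ++
            [Sum.inl k]) = l.flatMap fun k => (W k).map Sum.inr ++ [Sum.inl k] := by
          refine List.flatMap_congr fun k hk => ?_
          have hne : k ≠ a := fun h => ha (h ▸ hk)
          rw [Function.update_of_ne hne]
        conv_lhs => rw [hW]
        rw [List.flatMap_cons, List.flatMap_cons, hl', Function.update_self]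
        rfl

theorem List.map_inr_append_inl_cons_inj {α β : Type*} {a : α} {R R' : List (α ⊕ β)} :
    ∀ {A A' : List β}, A.map Sum.inr ++ Sum.inl a :: R = A'.map Sum.inr ++ Sum.inl a :: R' →
      A = A' ∧ R = R'
  | [], [], h => ⟨rfl, (List.cons.inj h).2⟩
  | [], _ :: _, h => absurd (List.cons.inj h).1 (by simp)
  | _ :: _, [], h => absurd (List.cons.inj h).1 (by simp)
  | x :: A, y :: A', h => by
    obtain ⟨h1, h2⟩ := List.cons.inj h
    obtain ⟨h3, h4⟩ := List.map_inr_append_inl_cons_inj (A := A) (A' := A') h2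
    exact ⟨by rw [Sum.inr.inj h1, h3], h4⟩

theorem List.flatMap_inr_append_inl_inj {α β : Type*} {W W' : α → List β} (l : List α)
    (h : l.flatMap (fun k => (W k).map Sum.inr ++ [Sum.inl k]) =
      l.flatMap fun k => (W' k).map Sum.inr ++ [Sum.inl k]) : ∀ k ∈ l, W k = W' k := by
  induction l with
  | nil => simp
  | cons a l ih =>
    rw [List.flatMap_cons, List.flatMap_cons, List.append_assoc, List.append_assoc] at h
    obtain ⟨h1, h2⟩ := List.map_inr_append_inl_cons_inj h
    intro k hk
    rcases List.mem_cons.1 hk with rfl | hk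
    · exact h1
    · exact ih h2 k hk

namespace FloorDiagram

variable {d : ℕ}

/-- The label of a black vertex: the edge on which it lies, or the target of the left end. -/
abbrev Black (d : ℕ) : Type := WEdge d ⊕ Fin d

/-- The label of a vertex of a marked floor diagram. -/
abbrev Letter (d : ℕ) : Type := Fin d ⊕ Black d

/-- Whether vertices with the given labels may occur in the given order. -/
def Before : Letter d → Letter d → Prop
  | Sum.inl v, Sum.inl w => v < w
  | Sum.inl v, Sum.inr (Sum.inl e) => v < e.tgt
  | Sum.inl v, Sum.inr (Sum.inr t) => v < t
  | Sum.inr (Sum.inl e), Sum.inl v => e.src < v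
  | Sum.inr (Sum.inr _), Sum.inl _ => True
  | Sum.inr _, Sum.inr _ => True

/-- The weight of the edge between vertices with given labels. -/
noncomputable def letterAdj : Letter d → Letter d → ℕ
  | Sum.inl v, Sum.inr (Sum.inl e) => if e.src = v then e.wt else 0
  | Sum.inr (Sum.inl e), Sum.inl v => if e.tgt = v then e.wt else 0
  | Sum.inr (Sum.inr t), Sum.inl v => if t = v then 1 else 0
  | _, _ => 0

/-- The label of a vertex, where `t` gives the targets of the left ends. -/
def label (D : FloorDiagram d) (t : Fin d → Fin d) : D.MVertex → Letter d
  | Sum.inl v => Sum.inl v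
  | Sum.inr (Sum.inl e) => Sum.inr (Sum.inl e.1)
  | Sum.inr (Sum.inr i) => Sum.inr (Sum.inr (t i))

theorem map_label (D : FloorDiagram d) (t : Fin d → Fin d) :
    Finset.univ.val.map (D.label t) = Finset.univ.val.map Sum.inl +
      (D.edges.map Sum.inl + (Finset.univ.val.map t).map Sum.inr).map Sum.inr := by
  have h1 : (Finset.univ : Finset D.MVertex).val = (Finset.univ.val.map Sum.inl) +
      ((Finset.univ.val.map Sum.inl) + (Finset.univ.val.map Sum.inr)).map Sum.inr := rfl
  rw [h1, Multiset.map_add, Multiset.map_map, Multiset.map_map, Multiset.map_add, Multiset.map_map,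
    Multiset.map_map, Multiset.map_add, Multiset.map_map, Multiset.map_map, Multiset.map_map]
  congr 2
  exact Multiset.map_univ D.edges (fun e => (Sum.inr (Sum.inl e) : Letter d))

namespace Marking

variable {D : FloorDiagram d}

/-- The sequence of labels of the vertices in the total order of a marking. -/
def word (M : D.Marking) (p : Fin (Fintype.card D.MVertex)) : Letter d :=
  D.label M.target (M.pos.symm p)

theorem adj_eq (M : D.Marking) (x y : D.MVertex) :
    M.adj x y = letterAdj (D.label M.target x) (D.label M.target y) := by
  rcases x with v | e | i <;> rcases y with w | e' | j <;> rfl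

theorem label_eq_of_equiv {M M' : D.Marking} {σ : D.MVertex ≃ D.MVertex}
    (h1 : ∀ v : Fin d, σ (Sum.inl v) = Sum.inl v)
    (h2 : ∀ x y, M'.adj (σ x) (σ y) = M.adj x y) (x : D.MVertex) :
    D.label M'.target (σ x) = D.label M.target x := by
  have h3 : ∀ v, M'.adj (Sum.inl v) (σ x) = M.adj (Sum.inl v) x := fun v => by rw [← h2, h1]
  have h4 : ∀ v, M'.adj (σ x) (Sum.inl v) = M.adj x (Sum.inl v) := fun v => by rw [← h2, h1]
  rcases x with v | e | i
  · rw [h1]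
    rfl
  · have hpos : e.1.wt ≠ 0 := by
      have := D.wt_pos e.1 (Multiset.coe_mem (x := e))
      omega
    have h5 := h3 e.1.src
    have h6 := h4 e.1.tgt
    rcases hσ : σ (Sum.inr (Sum.inl e)) with v | e' | i
    · rw [hσ] at h5
      simp [adj, hpos.symm] at h5
    · rw [hσ] at h5 h6
      simp only [adj, if_true] at h5 h6
      have hs : e'.1.src = e.1.src := by
        by_contra h
        rw [if_neg h] at h5
        exact hpos h5.symm
      have ht : e'.1.tgt = e.1.tgt := by
        by_contra h
        rw [if_neg h] at h6
        exact hpos h6.symm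
      rw [if_pos hs] at h5
      exact congrArg (fun e => (Sum.inr (Sum.inl e) : Letter d)) (WEdge.ext hs ht h5)
    · rw [hσ] at h5
      simp [adj, hpos.symm] at h5
  · have h6 := h4 (M.target i)
    rcases hσ : σ (Sum.inr (Sum.inr i)) with v | e' | j
    · rw [hσ] at h6
      simp [adj] at h6
    · have h5 := h3 e'.1.src
      have := D.wt_pos e'.1 (Multiset.coe_mem (x := e'))
      rw [hσ] at h5
      simp only [adj, if_true] at h5
      omega
    · rw [hσ] at h6
      simp only [adj, if_true] at h6
      have : M'.target j = M.target i := by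
        by_contra h
        rw [if_neg h] at h6
        exact absurd h6 (by norm_num)
      exact congrArg (fun e => (Sum.inr (Sum.inr e) : Letter d)) this

theorem equiv_iff {M M' : D.Marking} : M ≈ M' ↔ M.word = M'.word := by
  constructor
  · rintro ⟨σ, h1, h2, h3⟩
    have hpos : ∀ x, M'.pos (σ x) = M.pos x := by
      let τ : Fin (Fintype.card D.MVertex) ≃ Fin (Fintype.card D.MVertex) :=
        M.pos.symm.trans (σ.trans M'.pos)
      have hτ : StrictMono τ := fun p q hpq => by
        simp only [τ, Equiv.trans_apply]
        rw [h3]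
        simpa using hpq
      have h4 := Subsingleton.elim (hτ.orderIsoOfSurjective τ τ.surjective) (OrderIso.refl _)
      intro x
      have h5 := DFunLike.congr_fun h4 (M.pos x)
      simpa [τ] using h5
    funext p
    obtain ⟨x, rfl⟩ := M.pos.surjective p
    have h4 := label_eq_of_equiv h1 h2 x
    rw [word, word, Equiv.symm_apply_apply, ← hpos x, Equiv.symm_apply_apply, h4]
  · intro h
    let σ : D.MVertex ≃ D.MVertex := M.pos.trans M'.pos.symm
    have hlab : ∀ x, D.label M'.target (σ x) = D.label M.target x := fun x => by
      have := congrFun h (M.pos x)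
      rw [word, word, Equiv.symm_apply_apply] at this
      exact this.symm
    refine ⟨σ, fun v => ?_, fun x y => ?_, fun x y => ?_⟩
    · have := hlab (Sum.inl v)
      rcases hσ : σ (Sum.inl v) with w | e | i <;> rw [hσ] at this
      · exact congrArg Sum.inl (Sum.inl.inj this)
      · exact absurd this (by simp [label])
      · exact absurd this (by simp [label])
    · rw [adj_eq, adj_eq, hlab, hlab]
    · simp [σ]

theorem white_lt_iff (M : D.Marking) {v w : Fin d} :
    M.pos (Sum.inl v) < M.pos (Sum.inl w) ↔ v < w := by
  refine ⟨fun h => ?_, M.white_lt v w⟩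
  by_contra hle
  rcases (not_lt.1 hle).lt_or_eq with hlt | rfl
  · exact lt_asymm h (M.white_lt w v hlt)
  · exact lt_irrefl _ h

theorem before_word (M : D.Marking) {p q : Fin (Fintype.card D.MVertex)} (hpq : p < q) :
    Before (M.word p) (M.word q) := by
  obtain ⟨x, rfl⟩ := M.pos.surjective p
  obtain ⟨y, rfl⟩ := M.pos.surjective q
  rw [word, word, Equiv.symm_apply_apply, Equiv.symm_apply_apply]
  rcases x with v | e | i <;> rcases y with w | e' | j
  · exact M.white_lt_iff.1 hpq
  · exact M.white_lt_iff.1 (hpq.trans (M.lt_tgt e'))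
  · exact M.white_lt_iff.1 (hpq.trans (M.end_lt j))
  · exact M.white_lt_iff.1 ((M.src_lt e).trans hpq)
  all_goals trivial

end Marking

/-- The multiset of all black vertices of a word. -/
def blacks (W : Fin d → List (Black d)) : Multiset (Black d) := ∑ k, (W k : Multiset (Black d))

/-- The list of all vertices of a word, where `W k` lists the black vertices between the white
vertices `k - 1` and `k`. -/
def wordList (W : Fin d → List (Black d)) : List (Letter d) :=
  (List.finRange d).flatMap fun k => (W k).map Sum.inr ++ [Sum.inl k]

/-- The words that encode markings of a floor diagram. -/
structure IsWord (D : FloorDiagram d) (W : Fin d → List (Black d)) : Prop where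
  edge_mem : ∀ k e, Sum.inl e ∈ W k → e.src < k ∧ k ≤ e.tgt
  end_mem : ∀ k t, Sum.inr t ∈ W k → k ≤ t
  blacks_eq : ∃ T : Multiset (Fin d), blacks W = D.edges.map Sum.inl + T.map Sum.inr ∧
    ∀ v, edgeDiv D.edges v + T.count v = 1

theorem wordList_injective : Function.Injective (wordList (d := d)) := fun _ _ h =>
  funext fun k => List.flatMap_inr_append_inl_inj _ h k (List.mem_finRange k)

theorem coe_wordList (W : Fin d → List (Black d)) :
    (wordList W : Multiset (Letter d)) =
      Finset.univ.val.map Sum.inl + (blacks W).map Sum.inr := by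
  have h : (wordList W : Multiset (Letter d)) = (Finset.univ : Finset (Fin d)).val.bind
      fun k => ((W k : Multiset (Black d)).map Sum.inr + {Sum.inl k}) := by
    rw [wordList, ← Multiset.coe_bind]
    rfl
  rw [h, Multiset.bind_add, Multiset.bind_singleton, add_comm, blacks]
  congr 1
  exact (map_sum (Multiset.mapAddMonoidHom (Sum.inr : Black d → Letter d))
    (fun k => (W k : Multiset (Black d))) Finset.univ).symm

theorem pairwise_finRange {R : Fin d → Fin d → Prop} :
    (List.finRange d).Pairwise R ↔ ∀ i j, i < j → R i j := by
  rw [← List.ofFn_id, List.pairwise_ofFn]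
  rfl

theorem pairwise_wordList (W : Fin d → List (Black d)) :
    (wordList W).Pairwise Before ↔
      (∀ k e, Sum.inl e ∈ W k → e.src < k ∧ k ≤ e.tgt) ∧ ∀ k t, Sum.inr t ∈ W k → k ≤ t := by
  rw [wordList, List.pairwise_flatMap, pairwise_finRange]
  constructor
  · rintro ⟨h1, h2⟩
    have h3 : ∀ k b, b ∈ W k → ∀ j < k, Before (Sum.inl j) (Sum.inr b) := fun k b hb j hj =>
      h2 j k hj _ (by simp) _ (by simp [hb])
    have h4 : ∀ k b, b ∈ W k → Before (Sum.inr b) (Sum.inl k) := fun k b hb =>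
      (List.pairwise_append.1 (h1 k (List.mem_finRange k))).2.2 _ (by simp [hb]) _ (by simp)
    refine ⟨fun k e he => ⟨h4 k _ he, ?_⟩, fun k t ht => ?_⟩
    · by_contra h
      exact lt_irrefl _ (h3 k _ he e.tgt (not_le.1 h))
    · by_contra h
      exact lt_irrefl _ (h3 k _ ht t (not_le.1 h))
  · rintro ⟨h1, h2⟩
    have h3 : ∀ k b, b ∈ W k → ∀ j, k ≤ j → Before (Sum.inr b) (Sum.inl j) := by
      rintro k (e | t) hb j hj
      · exact (h1 k e hb).1.trans_le hj
      · trivial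
    have h4 : ∀ k b, b ∈ W k → ∀ j < k, Before (Sum.inl j) (Sum.inr b) := by
      rintro k (e | t) hb j hj
      · exact hj.trans_le (h1 k e hb).2
      · exact hj.trans_le (h2 k t hb)
    have h5 : ∀ b b' : Black d, Before (Sum.inr b) (Sum.inr b') := by
      rintro (_ | _) (_ | _) <;> trivial
    refine ⟨fun k _ => ?_, fun i j hij x hx y hy => ?_⟩
    · rw [List.pairwise_append]
      refine ⟨List.pairwise_map.2 (List.pairwise_of_forall fun b b' => h5 b b'),
        List.pairwise_singleton _ _, fun x hx y hy => ?_⟩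
      obtain ⟨b, hb, rfl⟩ := List.mem_map.1 hx
      rw [List.mem_singleton.1 hy]
      exact h3 k b hb k le_rfl
    · rcases List.mem_append.1 hx with hx | hx <;> rcases List.mem_append.1 hy with hy | hy
      · obtain ⟨b, hb, rfl⟩ := List.mem_map.1 hx
        obtain ⟨b', hb', rfl⟩ := List.mem_map.1 hy
        exact h5 b b'
      · obtain ⟨b, hb, rfl⟩ := List.mem_map.1 hx
        rw [List.mem_singleton.1 hy]
        exact h3 i b hb j hij.le
      · obtain ⟨b', hb', rfl⟩ := List.mem_map.1 hy
        rw [List.mem_singleton.1 hx]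
        exact h4 j b' hb' i hij
      · rw [List.mem_singleton.1 hx, List.mem_singleton.1 hy]
        exact hij

theorem count_target (t : Fin d → Fin d) (v : Fin d) :
    (Finset.univ.val.map t).count v = (Finset.univ.filter fun i => t i = v).card := by
  rw [Multiset.count_map, Finset.card_def, Finset.filter_val]
  simp only [eq_comm]

theorem Marking.exists_word {D : FloorDiagram d} (M : D.Marking) :
    ∃ W, IsWord D W ∧ wordList W = List.ofFn M.word := by
  set L := List.ofFn M.word with hL
  have hpw : L.Pairwise Before := List.pairwise_ofFn.2 fun p q hpq => M.before_word hpq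
  have hmap : (L : Multiset (Letter d)) = Finset.univ.val.map (D.label M.target) := by
    rw [hL, ← Fin.univ_val_map]
    have h1 : M.word = D.label M.target ∘ M.pos.symm := rfl
    rw [h1, ← Multiset.map_map, Multiset.map_univ_val_equiv]
  have hmem : ∀ v : Fin d, Sum.inl v ∈ L := fun v => by
    rw [← Multiset.mem_coe, hmap]
    exact Multiset.mem_map.2 ⟨Sum.inl v, Finset.mem_univ _, rfl⟩
  have hwhite : L.filterMap Sum.getLeft? = List.finRange d := by
    refine List.Pairwise.eq_of_mem_iff (r := (· < ·)) ?_ (pairwise_finRange.2 fun _ _ h => h)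
      fun v => ?_
    · rw [List.pairwise_filterMap]
      refine hpw.imp ?_
      rintro (v | b) (w | b') h x hx y hy <;> simp at hx hy
      subst hx hy
      exact h
    · simp only [List.mem_filterMap, List.mem_finRange, iff_true]
      exact ⟨_, hmem v, rfl⟩
  obtain ⟨W, t, hW⟩ := List.exists_flatMap_eq L (by rw [hwhite]; exact List.nodup_finRange d)
  rw [hwhite] at hW
  have ht : t = [] := by
    rw [List.eq_nil_iff_forall_not_mem]
    intro b hb
    rw [hW, List.pairwise_append] at hpw
    have h1 : ∀ v, Before (Sum.inl v) (Sum.inr b) := fun v =>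
      hpw.2.2 _ (List.mem_flatMap.2 ⟨v, List.mem_finRange v, by simp⟩) _ (by simp [hb])
    rcases b with e | i
    · exact lt_irrefl _ (h1 e.tgt)
    · exact lt_irrefl _ (h1 i)
  rw [ht, List.map_nil, List.append_nil] at hW
  have hW' : wordList W = L := hW.symm
  rw [← hW'] at hpw hmap
  obtain ⟨h1, h2⟩ := (pairwise_wordList W).1 hpw
  refine ⟨W, ⟨h1, h2, Finset.univ.val.map M.target, ?_, fun v => ?_⟩, hW'⟩
  · rw [coe_wordList, map_label] at hmap
    exact Multiset.map_injective Sum.inr_injective (add_left_cancel hmap)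
  · rw [count_target]
    exact M.div_eq v

theorem sum_edgeDiv (E : Multiset (WEdge d)) : ∑ v, edgeDiv E v = 0 := by
  induction E using Multiset.induction_on with
  | empty => simp [edgeDiv]
  | cons a s ih =>
    have h1 : ∀ v : Fin d, edgeDiv (a ::ₘ s) v = edgeDiv s v +
        ((if a.tgt = v then (a.wt : ℤ) else 0) - (if a.src = v then (a.wt : ℤ) else 0)) := by
      intro v
      simp only [edgeDiv, Multiset.map_cons, Multiset.sum_cons]
      ring
    simp [h1, Finset.sum_add_distrib, ih]

theorem IsWord.exists_marking {D : FloorDiagram d} {W : Fin d → List (Black d)}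
    (hW : IsWord D W) : ∃ M : D.Marking, List.ofFn M.word = wordList W := by
  obtain ⟨h1, h2, T, hT, hdiv⟩ := hW
  have hcard : T.card = d := by
    have h3 := Finset.sum_congr rfl fun v (_ : v ∈ Finset.univ) => hdiv v
    rw [Finset.sum_add_distrib, sum_edgeDiv, zero_add] at h3
    have h4 : ∑ v, T.count v = T.card :=
      Multiset.sum_count_eq_card fun _ _ => Finset.mem_univ _
    rw [← h4]
    have h5 : ((∑ v, T.count v : ℕ) : ℤ) = d := by
      push_cast
      rw [h3]
      simp
    exact_mod_cast h5
  obtain ⟨t, rfl⟩ := Multiset.exists_map_univ_eq hcard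
  have hmap : Finset.univ.val.map (D.label t) = (wordList W : Multiset (Letter d)) := by
    rw [map_label, coe_wordList, hT]
  have hlen : (wordList W).length = Fintype.card D.MVertex := by
    have := congrArg Multiset.card hmap
    rw [Multiset.card_map, Multiset.coe_card] at this
    exact this.symm
  obtain ⟨g, hg⟩ := List.exists_ofFn_eq hlen
  rw [← hg, ← Fin.univ_val_map] at hmap
  obtain ⟨e, he⟩ := exists_equiv_of_map_univ_eq hmap
  have hpw := (pairwise_wordList W).2 ⟨h1, h2⟩
  rw [← hg, List.pairwise_ofFn] at hpw
  have hlt : ∀ x y, x ≠ y → ¬ Before (D.label t y) (D.label t x) → e x < e y := by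
    intro x y hne hb
    by_contra hle
    rcases (not_lt.1 hle).lt_or_eq with h | h
    · exact hb (by rw [← he, ← he]; exact hpw h)
    · exact hne (e.injective h).symm
  refine ⟨⟨t, fun v => ?_, e, fun v w hvw => ?_, fun x => ?_, fun x => ?_, fun i => ?_⟩, ?_⟩
  · rw [← count_target]
    exact hdiv v
  · exact hlt _ _ (fun h => hvw.ne (Sum.inl.inj h)) (fun h : w < v => lt_asymm hvw h)
  · exact hlt _ _ (by simp) (lt_irrefl x.1.src)
  · exact hlt _ _ (by simp) (lt_irrefl x.1.tgt)
  · exact hlt _ _ (by simp) (lt_irrefl (t i))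
  · rw [← hg]
    congr 1
    funext p
    rw [Marking.word, ← he]
    exact congrArg g (e.apply_symm_apply p)

/-- Equivalence classes of markings correspond to words. -/
theorem nu_eq_card (D : FloorDiagram d) : D.nu = Nat.card {W // IsWord D W} := by
  choose F hF hF' using fun M : D.Marking => M.exists_word
  refine Nat.card_congr (Equiv.ofBijective
    (Quotient.lift (fun M => (⟨F M, hF M⟩ : {W // IsWord D W})) fun M M' h => ?_) ⟨?_, ?_⟩)
  · refine Subtype.ext (wordList_injective ?_)
    rw [hF', hF', Marking.equiv_iff.1 h]
  · rintro ⟨M⟩ ⟨M'⟩ h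
    refine Quotient.sound (Marking.equiv_iff.2 (List.ofFn_injective ?_))
    rw [← hF', ← hF']
    exact congrArg (fun W => wordList W.1) h
  · rintro ⟨W, hW⟩
    obtain ⟨M, hM⟩ := hW.exists_marking
    refine ⟨Quotient.mk _ M, Subtype.ext (wordList_injective ?_)⟩
    rw [← hM]
    exact hF' M

end FloorDiagram

/-! ### Words as configurations of segments -/

namespace FloorDiagram

variable {d : ℕ}

/-- The segment that corresponds to a black vertex in front of the white vertex `k`. -/
def toSeg (k : Fin d) : Black d → Seg
  | Sum.inl e => ⟨k - 1 - e.src, e.tgt - k, e.wt⟩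
  | Sum.inr t => ⟨k, t - k, 1⟩

/-- The vertex with number `n`, or `k` if there is none. -/
def vertexOr (k : Fin d) (n : ℕ) : Fin d := if h : n < d then ⟨n, h⟩ else k

/-- The black vertex in front of the white vertex `k` that corresponds to a segment. -/
def ofSeg (k : Fin d) (x : Seg) : Black d :=
  if x.left < k then
    Sum.inl ⟨vertexOr k (k - 1 - x.left), vertexOr k (k + x.right), x.weight⟩
  else Sum.inr (vertexOr k (k + x.right))

/-- Whether a black vertex is allowed in front of the white vertex `k`. -/
def Fits (k : Fin d) : Black d → Prop
  | Sum.inl e => e.src < k ∧ k ≤ e.tgt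
  | Sum.inr t => k ≤ t

theorem vertexOr_eq {k v : Fin d} {n : ℕ} (h : n = v) : vertexOr k n = v := by
  subst h
  exact dif_pos v.2

theorem ofSeg_toSeg {k : Fin d} {b : Black d} (h : Fits k b) : ofSeg k (toSeg k b) = b := by
  rcases b with ⟨s, t, w⟩ | t
  · have h1 : (s : ℕ) < k := h.1
    have h2 : (k : ℕ) ≤ t := h.2
    refine (if_pos (show (k : ℕ) - 1 - s < k by omega)).trans (congrArg Sum.inl ?_)
    refine WEdge.ext (vertexOr_eq ?_) (vertexOr_eq ?_) rfl
    · change (k : ℕ) - 1 - (k - 1 - s) = s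
      omega
    · change (k : ℕ) + (t - k) = t
      omega
  · have h2 : (k : ℕ) ≤ t := h
    refine (if_neg (lt_irrefl (k : ℕ))).trans (congrArg Sum.inr (vertexOr_eq ?_))
    change (k : ℕ) + (t - k) = t
    omega

theorem fits_ofSeg {k : Fin d} {x : Seg} (h1 : x.right ≤ k.rev) (h2 : x.left ≤ d - 1 - k.rev)
    (h3 : x.left = d - 1 - k.rev → x.weight = 1) :
    Fits k (ofSeg k x) ∧ toSeg k (ofSeg k x) = x := by
  have hk := k.2
  rw [Fin.val_rev] at h1 h2 h3
  unfold ofSeg vertexOr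
  split_ifs with h4 h5 h6
  · refine ⟨⟨?_, ?_⟩, ?_⟩
    · simp only [Fin.lt_def]
      omega
    · simp only [Fin.le_def]
      omega
    · ext <;> simp only [toSeg]
      · omega
      · omega
  · omega
  · omega
  · omega
  · refine ⟨?_, ?_⟩
    · change (k : ℕ) ≤ k + x.right
      omega
    · ext <;> simp only [toSeg]
      · omega
      · omega
      · exact (h3 (by omega)).symm
  · omega

/-- The weight with which a black vertex crosses the gap in front of the white vertex `g`. -/
def blackCross : Black d → ℕ → ℕ
  | Sum.inl e, g => if e.src < g ∧ g ≤ e.tgt then e.wt else 0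
  | Sum.inr t, g => if g ≤ t then 1 else 0

/-- The sum of the weights over all gaps that are crossed. -/
def blackArea : Black d → ℕ
  | Sum.inl e => e.wt * (e.tgt - e.src)
  | Sum.inr t => t + 1

theorem cross_toSeg {k : Fin d} {b : Black d} (h : Fits k b) (g : Fin d) :
    (toSeg k b).cross k.rev g = blackCross b g.rev := by
  have hk := k.2
  have hg := g.2
  rcases b with ⟨s, t, w⟩ | t
  · obtain ⟨h1, h2⟩ := h
    simp only [Fin.lt_def, Fin.le_def] at h1 h2
    have := t.2
    simp only [toSeg, Seg.cross, blackCross, Fin.val_rev]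
    refine if_congr ?_ rfl rfl
    omega
  · have h2 : (k : ℕ) ≤ t := h
    have := t.2
    simp only [toSeg, Seg.cross, blackCross, Fin.val_rev]
    refine if_congr ?_ rfl rfl
    omega

theorem area_toSeg {k : Fin d} {b : Black d} (h : Fits k b) :
    (toSeg k b).area = blackArea b := by
  rcases b with ⟨s, t, w⟩ | t
  · obtain ⟨h1, h2⟩ := h
    simp only [Fin.lt_def, Fin.le_def] at h1 h2
    simp only [toSeg, Seg.area, blackArea]
    congr 1
    omega
  · have h2 : (k : ℕ) ≤ t := h
    simp only [toSeg, Seg.area, blackArea]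
    omega

theorem sum_blackCross (b : Black d) : ∑ g : Fin d, blackCross b g = blackArea b := by
  rcases b with e | t
  · simp only [blackCross, blackArea, Fin.val_fin_lt, Fin.val_fin_le]
    rw [← Finset.sum_filter, Finset.sum_const, smul_eq_mul, mul_comm]
    congr 1
    have : (Finset.univ.filter fun g : Fin d => e.src < g ∧ g ≤ e.tgt) = Finset.Ioc e.src e.tgt := by
      ext g
      simp
    rw [this, Fin.card_Ioc]
  · simp only [blackCross, blackArea, Fin.val_fin_le]
    rw [← Finset.sum_filter, Finset.sum_const, smul_eq_mul, mul_one]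
    have : (Finset.univ.filter fun g : Fin d => g ≤ t) = Finset.Iic t := by
      ext g
      simp
    rw [this, Fin.card_Iic]

/-- The total weight crossing the gap in front of the white vertex `g`. -/
def totalBlackCross (B : Multiset (Black d)) (g : ℕ) : ℕ := (B.map fun b => blackCross b g).sum

theorem totalBlackCross_add (B B' : Multiset (Black d)) (g : ℕ) :
    totalBlackCross (B + B') g = totalBlackCross B g + totalBlackCross B' g := by
  simp [totalBlackCross]

theorem totalBlackCross_cons (b : Black d) (B : Multiset (Black d)) (g : ℕ) :
    totalBlackCross (b ::ₘ B) g = blackCross b g + totalBlackCross B g := by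
  simp [totalBlackCross]

theorem totalBlackCross_self (B : Multiset (Black d)) : totalBlackCross B d = 0 := by
  refine Multiset.sum_eq_zero fun x hx => ?_
  obtain ⟨b, -, rfl⟩ := Multiset.mem_map.1 hx
  rcases b with e | t
  · exact if_neg fun h => absurd e.tgt.2 (by omega)
  · exact if_neg fun h => absurd t.2 (by omega)

/-- The divergence of a vertex is the difference of the crossing weights of the gaps on its two
sides. -/
theorem totalBlackCross_sub (E : Multiset (WEdge d)) (hE : ∀ e ∈ E, e.src < e.tgt)
    (T : Multiset (Fin d)) (v : Fin d) :
    (totalBlackCross (E.map Sum.inl + T.map Sum.inr) v : ℤ) -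
      totalBlackCross (E.map Sum.inl + T.map Sum.inr) (v + 1) = edgeDiv E v + T.count v := by
  have h1 : (totalBlackCross (E.map Sum.inl) v : ℤ) - totalBlackCross (E.map Sum.inl) (v + 1) =
      edgeDiv E v := by
    induction E using Multiset.induction_on with
    | empty => simp [totalBlackCross, edgeDiv]
    | cons e E ih =>
      have ih := ih fun e he => hE e (Multiset.mem_cons_of_mem he)
      have he : (e.src : ℕ) < e.tgt := hE e (Multiset.mem_cons_self e E)
      have h1 : (blackCross (Sum.inl e) v : ℤ) - blackCross (Sum.inl e) (v + 1) =
          (if e.tgt = v then (e.wt : ℤ) else 0) - if e.src = v then (e.wt : ℤ) else 0 := by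
        simp only [blackCross, Fin.ext_iff]
        push_cast
        split_ifs <;> omega
      simp only [edgeDiv, Multiset.map_cons, Multiset.sum_cons, totalBlackCross_cons] at ih ⊢
      push_cast
      linarith
  have h2 : (totalBlackCross (T.map Sum.inr : Multiset (Black d)) v : ℤ) -
      totalBlackCross (T.map Sum.inr : Multiset (Black d)) (v + 1) = T.count v := by
    induction T using Multiset.induction_on with
    | empty => simp [totalBlackCross]
    | cons t T ih =>
      have h1 : (blackCross (Sum.inr t) v : ℤ) - blackCross (Sum.inr t) (v + 1) =
          if v = t then 1 else 0 := by
        simp only [blackCross, Fin.ext_iff]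
        push_cast
        split_ifs <;> omega
      rw [Multiset.map_cons, totalBlackCross_cons, totalBlackCross_cons, Multiset.count_cons]
      push_cast
      linarith
  rw [totalBlackCross_add, totalBlackCross_add]
  push_cast
  linarith

theorem divergence_iff (E : Multiset (WEdge d)) (hE : ∀ e ∈ E, e.src < e.tgt)
    (T : Multiset (Fin d)) : (∀ v, edgeDiv E v + T.count v = 1) ↔
      ∀ g : Fin d, totalBlackCross (E.map Sum.inl + T.map Sum.inr) g = d - g := by
  set B : Multiset (Black d) := E.map Sum.inl + T.map Sum.inr
  have hsub : ∀ v : Fin d, (totalBlackCross B v : ℤ) - totalBlackCross B (v + 1) =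
      edgeDiv E v + T.count v := totalBlackCross_sub E hE T
  have h0 := totalBlackCross_self B
  constructor
  · intro h
    have key : ∀ j ≤ d, totalBlackCross B (d - j) = j := by
      intro j
      induction j with
      | zero => exact fun _ => h0
      | succ j ih =>
        intro hj
        have h1 := hsub ⟨d - (j + 1), by omega⟩
        rw [h] at h1
        simp only at h1
        rw [show d - (j + 1) + 1 = d - j by omega, ih (by omega)] at h1
        omega
    intro g
    have := key (d - g) (by omega)
    rwa [Nat.sub_sub_self g.2.le] at this
  · intro h v
    rw [← hsub]
    have h1 := h v
    have h2 : totalBlackCross B (v + 1) = d - (v + 1) := by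
      by_cases hv : (v : ℕ) + 1 < d
      · exact h ⟨v + 1, hv⟩
      · rw [show (v : ℕ) + 1 = d by have := v.2; omega, h0, Nat.sub_self]
    have := v.2
    omega

/-- The configuration of segments that corresponds to a word. -/
def toConfig (W : Fin d → List (Black d)) (i : Fin d) : List Seg := (W i.rev).map (toSeg i.rev)

@[to_additive]
theorem prod_toConfig {N : Type*} [CommMonoid N] {W : Fin d → List (Black d)}
    (hW : ∀ k, ∀ b ∈ W k, Fits k b) (φ : Fin d → Seg → N) (ψ : Black d → N)
    (h : ∀ k b, Fits k b → φ k.rev (toSeg k b) = ψ b) :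
    ∏ i, ((toConfig W i).map (φ i)).prod = ((blacks W).map ψ).prod := by
  refine (Equiv.prod_comp Fin.revPerm _).symm.trans ?_
  have h1 : ∀ k : Fin d, ((toConfig W (Fin.revPerm k)).map (φ (Fin.revPerm k))).prod =
      ((W k).map ψ).prod := fun k => by
    rw [toConfig, List.map_map, Fin.revPerm_apply, Fin.rev_rev]
    congr 1
    exact List.map_congr_left fun b hb => h k b (hW k b hb)
  simp only [h1]
  rw [blacks, ← Multiset.coe_mapAddMonoidHom, map_sum, Multiset.prod_sum]
  rfl

theorem IsWord.fits {D : FloorDiagram d} {W : Fin d → List (Black d)} (hW : IsWord D W) :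
    ∀ k, ∀ b ∈ W k, Fits k b := by
  rintro k (e | t) hb
  · exact hW.edge_mem k e hb
  · exact hW.end_mem k t hb

theorem sum_listCross_toConfig {W : Fin d → List (Black d)} (hW : ∀ k, ∀ b ∈ W k, Fits k b)
    (g : Fin d) :
    ∑ i : Fin d, Seg.listCross (toConfig W i) i g = totalBlackCross (blacks W) g.rev :=
  sum_toConfig hW (fun i x => x.cross i g) (fun b => blackCross b g.rev)
    fun _ _ h => cross_toSeg h g

theorem sum_listExcess_toConfig {W : Fin d → List (Black d)} (hW : ∀ k, ∀ b ∈ W k, Fits k b) :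
    ∑ i : Fin d, Seg.listExcess (toConfig W i) = ((blacks W).map fun b => blackArea b - 1).sum :=
  sum_toConfig hW (fun _ x => x.excess) (fun b => blackArea b - 1)
    fun _ _ h => by rw [Seg.excess, area_toSeg h]

theorem prod_listVal_toConfig {f : ℕ → ℚ} (hf : f 1 = 1) {D : FloorDiagram d}
    {W : Fin d → List (Black d)} (hW : IsWord D W) :
    ∏ i : Fin d, Seg.listVal f (toConfig W i) = (D.edges.map fun e => f e.wt).prod := by
  obtain ⟨T, hT, -⟩ := hW.blacks_eq
  have h := prod_toConfig hW.fits (fun _ x => f x.weight)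
    (Sum.elim (fun e => f e.wt) fun _ => 1) (by
      rintro k (e | t) -
      · rfl
      · exact hf)
  refine h.trans ?_
  rw [hT, Multiset.map_add, Multiset.map_map, Multiset.map_map, Multiset.prod_add]
  have h1 : (T.map ((Sum.elim (fun e : WEdge d => f e.wt) fun _ => 1) ∘ Sum.inr)).prod = 1 :=
    Multiset.prod_eq_one fun x hx => by
      obtain ⟨t, -, rfl⟩ := Multiset.mem_map.1 hx
      rfl
  rw [h1, mul_one]
  rfl

theorem sum_totalBlackCross (B : Multiset (Black d)) :
    ∑ g : Fin d, totalBlackCross B g = (B.map blackArea).sum := by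
  induction B using Multiset.induction_on with
  | empty => simp [totalBlackCross]
  | cons b B ih =>
    simp only [totalBlackCross_cons, Finset.sum_add_distrib, ih, sum_blackCross, Multiset.map_cons,
      Multiset.sum_cons]

theorem two_mul_sum_sub (d : ℕ) : 2 * ∑ g : Fin d, (d - (g : ℕ)) = d * (d + 1) := by
  have h : ∀ n : ℕ, 2 * ∑ j ∈ Finset.range n, (j + 1) = n * (n + 1) := fun n => by
    induction n with
    | zero => rfl
    | succ n ih =>
      rw [Finset.sum_range_succ, mul_add, ih]
      ring
  rw [Fin.sum_univ_eq_sum_range (fun g => d - g) d, ← h d,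
    ← Finset.sum_range_reflect (fun j => j + 1) d]
  congr 1
  refine Finset.sum_congr rfl fun j hj => ?_
  have := Finset.mem_range.1 hj
  omega

/-- The total excess of the configuration of a word is the cogenus. -/
theorem IsWord.excess_eq_cogenus {D : FloorDiagram d} {W : Fin d → List (Black d)}
    (hW : IsWord D W) : ((∑ i : Fin d, Seg.listExcess (toConfig W i) : ℕ) : ℤ) = D.cogenus := by
  obtain ⟨T, hT, hdiv⟩ := hW.blacks_eq
  have hcross := (divergence_iff D.edges D.src_lt_tgt T).1 hdiv
  have hdiv0 := Finset.sum_congr rfl fun v (_ : v ∈ Finset.univ) => hdiv v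
  have hcardT : (T.card : ℤ) = d := by
    rw [Finset.sum_add_distrib, sum_edgeDiv, zero_add] at hdiv0
    have h4 : ∑ v, T.count v = T.card :=
      Multiset.sum_count_eq_card fun _ _ => Finset.mem_univ _
    rw [← h4]
    push_cast
    rw [hdiv0]
    simp
  have hpos : ∀ b ∈ blacks W, 1 ≤ blackArea b := by
    intro b hb
    rw [hT, Multiset.mem_add, Multiset.mem_map, Multiset.mem_map] at hb
    rcases hb with ⟨e, he, rfl⟩ | ⟨t, -, rfl⟩
    · have h1 : (e.src : ℕ) < e.tgt := D.src_lt_tgt e he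
      exact Nat.mul_pos (D.wt_pos e he) (by omega)
    · exact Nat.succ_pos _
  have hexc : ((blacks W).map fun b => blackArea b - 1).sum + (blacks W).card =
      ((blacks W).map blackArea).sum := by
    rw [← smul_eq_mul (blacks W).card 1 |>.trans (mul_one _), ← Multiset.sum_replicate,
      ← Multiset.map_const', ← Multiset.sum_map_add]
    exact congrArg _ (Multiset.map_congr rfl fun b hb => Nat.sub_add_cancel (hpos b hb))
  have harea : ((blacks W).map blackArea).sum = ∑ g : Fin d, (d - (g : ℕ)) := by
    rw [Finset.sum_congr rfl fun g _ => (hcross g).symm, ← hT]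
    exact (sum_totalBlackCross _).symm
  rw [sum_listExcess_toConfig hW.fits]
  have hcardB : (blacks W).card = D.edges.card + T.card := by
    rw [hT]
    simp
  have hd : ((d : ℤ) - 1) * (d - 2) / 2 = ((d : ℤ) * (d + 1) - 4 * d + 2) / 2 := by
    congr 1
    ring
  rw [cogenus, genus, hd]
  have hsum' : 2 * ((∑ g : Fin d, (d - (g : ℕ)) : ℕ) : ℤ) = (d : ℤ) * (d + 1) := by
    exact_mod_cast two_mul_sum_sub d
  omega

theorem IsWord.isConfig {D : FloorDiagram d} {W : Fin d → List (Black d)} (hW : IsWord D W)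
    {δ : ℕ} (hD : D.cogenus = δ) : IsConfig d δ (toConfig W) := by
  obtain ⟨T, hT, hdiv⟩ := hW.blacks_eq
  refine ⟨fun i x hx => ?_, fun g => ?_, ?_⟩
  · obtain ⟨b, hb, rfl⟩ := List.mem_map.1 hx
    have hfit := hW.fits _ b hb
    have hi := i.2
    have hr := Fin.val_rev i
    rcases b with e | t
    · have hmem : (Sum.inl e : Black d) ∈ blacks W :=
        Multiset.mem_sum.2 ⟨i.rev, Finset.mem_univ _, hb⟩
      rw [hT, Multiset.mem_add, Multiset.mem_map, Multiset.mem_map] at hmem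
      have he : e ∈ D.edges := by simpa using hmem
      have h1 : (e.src : ℕ) < i.rev := hfit.1
      have h2 : (i.rev : ℕ) ≤ e.tgt := hfit.2
      have h3 := e.tgt.2
      refine ⟨D.wt_pos e he, ?_, ?_, ?_⟩ <;> simp only [toSeg] <;> omega
    · have h2 : (i.rev : ℕ) ≤ t := hfit
      have h3 := t.2
      refine ⟨le_rfl, ?_, ?_, fun _ => rfl⟩ <;> simp only [toSeg] <;> omega
  · rw [sum_listCross_toConfig hW.fits, hT, (divergence_iff D.edges D.src_lt_tgt T).1 hdiv,
      Fin.val_rev]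
    have := g.2
    omega
  · have := hW.excess_eq_cogenus
    rw [hD] at this
    exact_mod_cast this

theorem filterMap_getLeft (E : Multiset (WEdge d)) (T : Multiset (Fin d)) :
    (E.map Sum.inl + T.map Sum.inr : Multiset (Black d)).filterMap Sum.getLeft? = E := by
  induction E using Multiset.induction_on with
  | empty =>
    rw [Multiset.map_zero, zero_add]
    induction T using Multiset.induction_on with
    | empty => rfl
    | cons t T ih => rw [Multiset.map_cons, Multiset.filterMap_cons_none _ _ rfl, ih]
  | cons e E ih =>
    rw [Multiset.map_cons, Multiset.cons_add, Multiset.filterMap_cons_some Sum.getLeft? _ _ rfl, ih]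

theorem eq_map_filterMap (B : Multiset (Black d)) :
    B = (B.filterMap Sum.getLeft?).map Sum.inl + (B.filterMap Sum.getRight?).map Sum.inr := by
  induction B using Multiset.induction_on with
  | empty => rfl
  | cons b B ih =>
    rcases b with e | t
    · rw [Multiset.filterMap_cons_some Sum.getLeft? _ _ rfl, Multiset.filterMap_cons_none _ _ rfl,
        Multiset.map_cons, Multiset.cons_add, ← ih]
    · rw [Multiset.filterMap_cons_none _ _ rfl, Multiset.filterMap_cons_some Sum.getRight? _ _ rfl,
        Multiset.map_cons, Multiset.add_cons, ← ih]

theorem IsWord.edges_eq {D : FloorDiagram d} {W : Fin d → List (Black d)} (hW : IsWord D W) :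
    D.edges = (blacks W).filterMap Sum.getLeft? := by
  obtain ⟨T, hT, -⟩ := hW.blacks_eq
  rw [hT, filterMap_getLeft]

theorem toConfig_injOn {W W' : Fin d → List (Black d)} (hW : ∀ k, ∀ b ∈ W k, Fits k b)
    (hW' : ∀ k, ∀ b ∈ W' k, Fits k b) (h : toConfig W = toConfig W') : W = W' := by
  have key : ∀ V : Fin d → List (Black d), (∀ k, ∀ b ∈ V k, Fits k b) →
      ∀ k, V k = (toConfig V k.rev).map (ofSeg k) := fun V hV k => by
    rw [toConfig, Fin.rev_rev, List.map_map]
    conv_lhs => rw [← List.map_id (V k)]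
    exact List.map_congr_left fun b hb => (ofSeg_toSeg (hV k b hb)).symm
  funext k
  rw [key W hW, key W' hW', h]

theorem _root_.IsConfig.exists_word {δ : ℕ} {ω : Fin d → List Seg} (hω : IsConfig d δ ω) :
    ∃ (D : FloorDiagram d) (W : Fin d → List (Black d)), D.cogenus = δ ∧ IsWord D W ∧
      toConfig W = ω := by
  let W : Fin d → List (Black d) := fun k => (ω k.rev).map (ofSeg k)
  have hseg : ∀ k, ∀ x ∈ ω k.rev, Fits k (ofSeg k x) ∧ toSeg k (ofSeg k x) = x := fun k x hx => by
    obtain ⟨-, h1, h2, h3⟩ := hω.seg k.rev x hx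
    exact fits_ofSeg h1 h2 h3
  have hfits : ∀ k, ∀ b ∈ W k, Fits k b := fun k b hb => by
    obtain ⟨x, hx, rfl⟩ := List.mem_map.1 hb
    exact (hseg k x hx).1
  have hW : toConfig W = ω := by
    funext i
    simp only [toConfig, W, List.map_map]
    conv_rhs => rw [← List.map_id (ω i)]
    rw [Fin.rev_rev]
    exact List.map_congr_left fun x hx => (hseg i.rev x (by rwa [Fin.rev_rev])).2
  set E := (blacks W).filterMap Sum.getLeft? with hE
  set T := (blacks W).filterMap Sum.getRight?
  have hB : blacks W = E.map Sum.inl + T.map Sum.inr := eq_map_filterMap _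
  have hmem : ∀ e ∈ E, ∃ k, Sum.inl e ∈ W k := fun e he => by
    have h1 : (Sum.inl e : Black d) ∈ blacks W := by
      rw [hB]
      exact Multiset.mem_add.2 (Or.inl (Multiset.mem_map_of_mem _ he))
    obtain ⟨k, -, hk⟩ := Multiset.mem_sum.1 h1
    exact ⟨k, hk⟩
  have hlt : ∀ e ∈ E, e.src < e.tgt := fun e he => by
    obtain ⟨k, hk⟩ := hmem e he
    exact (hfits k _ hk).1.trans_le (hfits k _ hk).2
  have hwt : ∀ e ∈ E, 1 ≤ e.wt := fun e he => by
    obtain ⟨k, hk⟩ := hmem e he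
    obtain ⟨x, hx, hxe⟩ := List.mem_map.1 hk
    have h1 := (hseg k x hx).2
    rw [hxe] at h1
    have h2 := (hω.seg k.rev x hx).1
    rw [← h1] at h2
    exact h2
  have hdiv : ∀ v, edgeDiv E v + T.count v = 1 := by
    rw [divergence_iff E hlt T, ← hB]
    intro g
    have h1 := hω.cross g.rev
    rw [← hW, sum_listCross_toConfig hfits, Fin.rev_rev, Fin.val_rev] at h1
    rw [h1]
    have := g.2
    omega
  let D : FloorDiagram d := ⟨E, hlt, hwt, fun v => by have := hdiv v; omega⟩
  have hDW : IsWord D W := ⟨fun k e he => hfits k _ he, fun k t ht => hfits k _ ht, T, hB, hdiv⟩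
  refine ⟨D, W, ?_, hDW, hW⟩
  rw [← hDW.excess_eq_cogenus, hW, hω.excess]

open Classical in
/-- The weighted count of floor diagrams as a count in the local model of segments. -/
theorem sum_nu_mul_prod {f : ℕ → ℚ} (hf : f 1 = 1) (δ d : ℕ) :
    ∑ D : FloorDiagram d with D.cogenus = (δ : ℤ),
      (D.nu : ℚ) * (D.edges.map fun e => f e.wt).prod = (segModel f δ).count d δ := by
  obtain ⟨Ω, hΩ, hsum⟩ := exists_configs d δ
  rw [← hsum f hf]
  let F : (Σ D : {D : FloorDiagram d // D.cogenus = (δ : ℤ)}, {W // IsWord D.1 W}) →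
      {ω // ω ∈ Ω} := fun s => ⟨toConfig s.2.1, (hΩ _).2 (s.2.2.isConfig s.1.2)⟩
  have hF : Function.Bijective F := by
    constructor
    · rintro ⟨⟨D, hD⟩, W, hW⟩ ⟨⟨D', hD'⟩, W', hW'⟩ h
      obtain rfl : W = W' := toConfig_injOn hW.fits hW'.fits (congrArg Subtype.val h)
      obtain rfl : D = D' := FloorDiagram.ext (hW.edges_eq.trans hW'.edges_eq.symm)
      rfl
    · rintro ⟨ω, hω⟩
      obtain ⟨D, W, hD, hW, h⟩ := ((hΩ ω).1 hω).exists_word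
      exact ⟨⟨⟨D, hD⟩, W, hW⟩, Subtype.ext h⟩
  have hfin : ∀ D : {D : FloorDiagram d // D.cogenus = (δ : ℤ)}, Finite {W // IsWord D.1 W} :=
    fun D => Finite.of_injective (fun W => F ⟨D, W⟩) fun W W' h => by
      simpa using hF.1 h
  let hft : ∀ D : {D : FloorDiagram d // D.cogenus = (δ : ℤ)}, Fintype {W // IsWord D.1 W} :=
    fun D => Fintype.ofFinite _
  rw [← Finset.sum_coe_sort Ω, ← (Equiv.ofBijective F hF).sum_comp, Fintype.sum_sigma,
    Finset.sum_subtype (Finset.univ.filter fun D : FloorDiagram d => D.cogenus = (δ : ℤ))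
      (p := fun D => D.cogenus = (δ : ℤ)) (by simp)]
  refine Finset.sum_congr rfl fun D _ => ?_
  have h1 : ∀ W : {W // IsWord D.1 W}, ∏ i, Seg.listVal f
      ((Equiv.ofBijective F hF ⟨D, W⟩ : {ω // ω ∈ Ω}).1 i) =
        (D.1.edges.map fun e => f e.wt).prod := fun W => prod_listVal_toConfig hf W.2
  rw [Finset.sum_congr rfl fun W _ => h1 W, Finset.sum_const, nsmul_eq_mul, nu_eq_card,
    Nat.card_eq_fintype_card, Finset.card_univ]

/-- The weighted count of floor diagrams of given cogenus is eventually polynomial in the degree. -/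
theorem eventuallyPoly_sum_nu_mul_prod {f : ℕ → ℚ} (hf : f 1 = 1) (δ : ℕ) :
    EventuallyPoly (fun d => open Classical in ∑ D : FloorDiagram d with D.cogenus = (δ : ℤ),
      (D.nu : ℚ) * (D.edges.map fun e => f e.wt).prod) (2 * δ)
      (((f 2 + 2) / 2) ^ δ / (δ.factorial : ℚ)) := by
  simp only [sum_nu_mul_prod hf]
  convert LocalModel.eventuallyPoly_count (𝓜 := segModel f δ) δ using 1
  rcases Nat.eq_zero_or_pos δ with rfl | hδ
  · simp [LocalModel.leadCoeff]
  · rw [LocalModel.leadCoeff, unitCount_segModel hf hδ]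

end FloorDiagram

theorem theorem5p9 (K : Type*) [Field K] [CharZero K] (δ : ℕ) :
    ∃ P Q : Polynomial ℚ,
      P.natDegree = 2 * δ ∧ Q.degree = ((2 * δ : ℕ) : WithBot ℕ) ∧
      ∃ d₀ : ℕ, ∀ d : ℕ, d₀ ≤ d →
        ∃ p q : ℤ, P.eval (d : ℚ) = (p : ℚ) ∧ Q.eval (d : ℚ) = (q : ℚ) ∧
          arithmeticCount K δ d = p • GW.hyp K + q • GW.diag (1 : Kˣ) := by
  classical
  obtain ⟨C, hC1, hC2, hC3⟩ := FloorDiagram.eventuallyPoly_sum_nu_mul_prod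
    (f := fun w => (w : ℚ) ^ 2) (by norm_num) δ
  obtain ⟨Q, hQ1, hQ2, hQ3⟩ := FloorDiagram.eventuallyPoly_sum_nu_mul_prod
    (f := fun w => if Odd w then 1 else 0) (by norm_num) δ
  have hQ2' : Q.coeff (2 * δ) = 1 / (δ.factorial : ℚ) := by
    rw [hQ2, if_neg (by decide)]
    norm_num
  have hC2' : C.coeff (2 * δ) = 3 ^ δ / (δ.factorial : ℚ) := by
    rw [hC2]
    norm_num
  have hfac : (δ.factorial : ℚ) ≠ 0 := by positivity
  refine ⟨Polynomial.C (1 / 2) * (C - Q), Q, ?_, ?_, ?_⟩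
  · rw [Polynomial.natDegree_C_mul (by norm_num)]
    have hle : (C - Q).natDegree ≤ 2 * δ := 
      (Polynomial.natDegree_sub_le_of_le hC1 hQ1).trans (max_self _).le
    rcases Nat.eq_zero_or_pos δ with rfl | hδ
    · omega
    · refine Polynomial.natDegree_eq_of_le_of_coeff_ne_zero hle ?_
      rw [Polynomial.coeff_sub, hC2', hQ2', ← sub_div]
      have : (1 : ℚ) < 3 ^ δ := one_lt_pow₀ (by norm_num) hδ.ne'
      exact div_ne_zero (by linarith) hfac
  · refine Polynomial.degree_eq_of_le_of_coeff_ne_zero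
      (Polynomial.degree_le_of_natDegree_le hQ1) ?_
    rw [hQ2']
    exact one_div_ne_zero hfac
  · obtain ⟨d₀, hd₀⟩ := Filter.eventually_atTop.1 (hC3.and hQ3)
    refine ⟨d₀, fun d hd => ?_⟩
    obtain ⟨h1, h2⟩ := hd₀ d hd
    choose p q hpq hq hp using fun D : FloorDiagram d => D.mult_eq K
    have hodd : ∀ D : FloorDiagram d,
        (q D : ℚ) = (D.edges.map fun e => if Odd e.wt then (1 : ℚ) else 0).prod := fun D => by
      have := congrArg (Int.castRingHom ℚ) (hq D)
      rw [map_multiset_prod, Multiset.map_map] at this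
      simpa [Function.comp_def] using this
    have hsq : ∀ D : FloorDiagram d,
        2 * (p D : ℚ) + q D = (D.edges.map fun e => (e.wt : ℚ) ^ 2).prod := fun D => by
      have := congrArg (Int.castRingHom ℚ) (hp D)
      rw [map_multiset_prod, Multiset.map_map] at this
      simpa [Function.comp_def] using this
    refine ⟨∑ D : FloorDiagram d with D.cogenus = (δ : ℤ), D.nu • p D,
      ∑ D : FloorDiagram d with D.cogenus = (δ : ℤ), D.nu • q D, ?_, ?_, ?_⟩
    · rw [Polynomial.eval_mul, Polynomial.eval_C, Polynomial.eval_sub, ← h1, ← h2,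
        ← Finset.sum_sub_distrib, Finset.mul_sum]
      push_cast
      refine Finset.sum_congr rfl fun D _ => ?_
      rw [← hsq, ← hodd]
      simp
      ring
    · rw [← h2]
      push_cast
      refine Finset.sum_congr rfl fun D _ => ?_
      rw [← hodd]
      simp
    · rw [arithmeticCount, Finset.sum_smul, Finset.sum_smul, ← Finset.sum_add_distrib]
      refine Finset.sum_congr (by congr) fun D _ => ?_
      rw [hpq, smul_add, smul_assoc, smul_assoc]
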